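/- **The algebra.** Let $A$ be the path algebra over $\mathbb F_2$ of the quiver with vertices $\iota_0,\iota_1$ and arrows $\rho_1,\rho_3:\iota_0\to\iota_1$, $\rho_2,\rho_4:\iota_1\to\iota_0$, modulo $\rho_2\rho_1=\rho_3\rho_2=\rho_4\rho_3=\rho_1\rho_4=0$ (products are concatenations of paths, so $\rho_1=\iota_0\rho_1\iota_1$). It has the basis of basic elements $\iota_0,\iota_1$ and Reeb elements $\rho_{i,\dots,i+n}=\rho_i\rho_{i+1}\cdots\rho_{i+n}$ ($i\in\mathbb Z/4$, $n\ge 0$). Let $\mathcal A_-=A[U]=\mathbb F_2[U]\otimes A$, with the following $\mathbb F_2[U]$-multilinear operations $\mu_n^w$ ($n,w\ge 0$), which are those of the weighted $A_\infty$-algebra of the torus. The operation $\mu_2^0$ is the multiplication; $\mu_0^1=\rho_{1234}+\rho_{2341}+\rho_{3412}+\rho_{4123}$ and $\mu_0^w=0$ for $w\ne1$; for $n\geq 1$ and $(n,w)\ne(2,0)$, $\mu_n^w$ vanishes if some input is $\iota_0$ or $\iota_1$, and for Reeb elements $\mu_n^w(\rho^1,\dots,\rho^n)$ is the sum of the output elements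 of all (isomorphism classes of) tiling patterns of weight $w$ with chord sequence $\rho^1\otimes\cdots\otimes\rho^n$. Here a *centered tiling pattern* is a connected graph $\Gamma$ embedded in the disk $\mathbb D$, meeting $\partial\mathbb D$ exactly in its univalent vertices, one of which is chosen as root, such that there is at least one internal vertex, each internal vertex is $4$-valent, each component of $\mathbb D\setminus\Gamma$ that does not meet $\partial\mathbb D$ is bounded by an embedded cycle with exactly $4$ edges and $4$ vertices, and the sectors at internal vertices are labelled by $\{1,2,3,4\}$ so that the labels around each vertex are, counterclockwise and up to cyclic order, $4,3,2,1$, and so that along every oriented edge between internal vertices the label to its right increases by $1$ modulo $4$. In an *extended tiling pattern* one or more $2$-valent vertices are inserted in the root edge, and their sectors on one of the two sides of that edge (the same side for all) are also labelled, following the same rule along edges. The *weight* is the rank of $H_1(\Gamma)$. The univalent vertices cut $\partial\mathbb D$ into intervals; traversing $\partial \mathbb D$ counterclockwise from the root, each interval contributes to the *chord sequence* the product of the $\rho_j$ for the labels $j$ of the sectors successively visible from it. If $d$ is the number of $4$-valent vertices, the *output element* is $U^d$ times the left idempotent of $\rho_j$, where $j$ is the label of the first visible sector (centered case), or $U^d$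 times the product, in order, of the $\rho_j$ for the labels $j$ at the $2$-valent vertices (extended case). **Gradings.** For a group $\Gamma$ and central elements $\lambda_d,\lambda_w\in\Gamma$, a $(\Gamma,\lambda_d,\lambda_w)$-grading of $\mathcal A_-$ is a decomposition $\mathcal A_-=\bigoplus_{g\in \Gamma}(\mathcal A_-)_g$ into sub-bimodules over $\mathbb F_2\iota_0\oplus\mathbb F_2\iota_1$ such that for all $n,w\ge 0$ and homogeneous $a_1,\dots,a_n$ of degrees $g_1,\dots,g_n$, the element $\mu_n^w(a_1,\dots,a_n)$ is homogeneous of degree $\lambda_d^{n-2}\lambda_w^w g_1\cdots g_n$. **The groups.** On the quintuples $(m;a,b,c,d)\in\frac12\mathbb Z\times\mathbb Z^4$ take the multiplication $$(m;a,b,c,d)(m';a',b',c',d')=\Bigl(m+m'+\tfrac12\bigl[(ab'-ba')+(bc'-cb')+(cd'-dc')+(da'-ad')\bigr];\,a+a',b+b',c+c',d+d'\Bigr).$$ Let $G'$ be the subgroup generated by $(1;0,0,0,0)$ and $(-\frac12;1,0,0,0)$, $(-\frac12;0,1,0,0)$, $(-\frac12;0,0,1,0)$, $(-\frac12;0,0,0,1)$;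 it is a non-commutative central extension of $\mathbb Z^4$ by $\mathbb Z$. Let $G$ be the group of $(m;a,b)\in(\frac12\mathbb Z)^3$ with $a+b\in\mathbb Z$ and $m+\frac{(2a+1)(a+b+1)+1}{2}\in\mathbb Z$, with multiplication $(m;a,b)(n;c,d)=(m+n+ad-bc;a+c,b+d)$, and let $G(\mathbb T)=\{(m;a,b)\in G\mid a,b\in\mathbb Z\}$. There is a homomorphism $\pi:G'\to G$, $(j;a,b,c,d)\mapsto\bigl(j-d;\frac{a+b-c-d}{2},\frac{-a+b+c-d}{2}\bigr)$. **Theorem.** Put $\operatorname{gr}'(\iota_0)=\operatorname{gr}'(\iota_1)=(0;0,0,0,0)$; for $\rho=\rho_{i,\dots,i+n}$ put $\operatorname{gr}'(\rho)=(-\frac{n+1}4;[\rho])$ if $4\mid n+1$ and $\operatorname{gr}'(\rho)=(-\frac12-\lfloor\frac{n+1}4\rfloor;[\rho])$ otherwise, where $[\rho]\in\mathbb Z^4$ records the number of occurrences of $\rho_1,\dots,\rho_4$ in $\rho$; put $\operatorname{gr}'(U)=(-1;1,1,1,1)$ and $\operatorname{gr}'(U^kb)=\operatorname{gr}'(U)^k\operatorname{gr}'(b)$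 for basic elements $b$. In each case below the homogeneous part of degree $g$ is the $\mathbb F_2$-span of the elements $U^kb$ of degree $g$. 1. $\operatorname{gr}'$ defines a $(G',\lambda_d,\lambda_w)$-grading of $\mathcal A_-$ with $\lambda_d=(1;0,0,0,0)$ and $\lambda_w=(1;1,1,1,1)$. 2. $\pi(\lambda_d)=(1;0,0)$, $\pi(\lambda_w)=(0;0,0)$, and $\operatorname{gr}=\pi\circ\operatorname{gr}'$ defines a $(G,(1;0,0),(0;0,0))$-grading of $\mathcal A_-$. 3. With $\psi(\iota_0)=(0;0,0)$ and $\psi(\iota_1)=\operatorname{gr}(\rho_1)$, the assignment $\operatorname{gr}_\psi(U^kb)=\psi(\iota_x)\operatorname{gr}(U^kb)\psi(\iota_y)^{-1}$ for $b=\iota_xb\iota_y$ takes values in $G(\mathbb T)$ and defines a $(G(\mathbb T),(1;0,0),(0;0,0))$-grading of $\mathcal A_-$. -/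

import Mathlib

namespace TorusAlgebra

/-! ## The associative algebra and its basic elements -/

/-- Basic elements: the idempotents `ι₀, ι₁`, and the Reeb elements
`reeb i n = ρ_i ρ_{i+1} ⋯ ρ_{i+n}` of length `n + 1`, with indices in `ℤ/4` (so `0` stands
for `4`). -/
inductive Basic : Type
  | idem (x : Fin 2) : Basic
  | reeb (i : ZMod 4) (n : ℕ) : Basic
  deriving DecidableEq

/-- The idempotent `x` with `ι_x ρ_i = ρ_i`: the arrows `ρ₁, ρ₃` start at `ι₀` and the arrows
`ρ₂, ρ₄` start at `ι₁`. -/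
def source (i : ZMod 4) : Fin 2 := if i = 1 ∨ i = 3 then 0 else 1

/-- The idempotent `x` with `ι_x b = b`. -/
def Basic.left : Basic → Fin 2
  | .idem x => x
  | .reeb i _ => source i

/-- The idempotent `x` with `b ι_x = b`; the arrow `ρ_j` ends where `ρ_{j+1}` starts. -/
def Basic.right : Basic → Fin 2
  | .idem x => x
  | .reeb i n => source (i + n + 1)

/-- Product of basic elements in the path algebra of the quiver with arrows
`ρ₁, ρ₃ : ι₀ → ι₁`, `ρ₂, ρ₄ : ι₁ → ι₀` modulo `ρ₂ρ₁ = ρ₃ρ₂ = ρ₄ρ₃ = ρ₁ρ₄ = 0`.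
The product is a basic element or zero; `none` stands for zero. -/
def Basic.mul : Basic → Basic → Option Basic
  | .idem x, b => if x = b.left then some b else none
  | .reeb i n, .idem x => if (Basic.reeb i n).right = x then some (.reeb i n) else none
  | .reeb i n, .reeb j m => if j = i + n + 1 then some (.reeb i (n + m + 1)) else none

/-- The product `ρ_{l₁} ρ_{l₂} ⋯ ρ_{l_k}` in the path algebra, for a nonempty list `l`;
`none` stands for zero. (The value at the empty list is never used.) -/
def chordProd : List (ZMod 4) → Option Basic
  | [] => none
  | [i] => some (.reeb i 0)
  | i :: j :: l => (chordProd (j :: l)).bind (Basic.mul (.reeb i 0))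

/-- The underlying `𝔽₂[U]`-module of the algebra: free on the basic elements. -/
abbrev Alg : Type := Basic →₀ Polynomial (ZMod 2)

/-- The element `U^k b`. -/
noncomputable def elt (k : ℕ) (b : Basic) : Alg := Finsupp.single b (Polynomial.X ^ k)

/-- `U^k b`, with `none` standing for zero. -/
noncomputable def eltOpt (k : ℕ) : Option Basic → Alg
  | none => 0
  | some b => elt k b

/-- The idempotents as elements of the algebra. -/
noncomputable def iota (x : Fin 2) : Alg := elt 0 (.idem x)

/-! ## Tiling patterns

A graph embedded in the disk, considered up to isotopy, is encoded by its combinatorial map.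
The *darts* are the half-edges at the internal (`4`-valent) vertices. -/

/-- The extension data of a tiling pattern. For an extended pattern the list contains the
labels of the distinguished sectors of the `2`-valent vertices on the root edge, in the order
in which they are met when the boundary of the disk is traversed in the positive direction.
"Left" and "right" refer to the root edge oriented towards the root; the left side of that
edge is seen from the first boundary interval, the right side from the last. -/
inductive Extension : Type
  | centered : Extension
  | left (l : List (ZMod 4)) : Extension
  | right (l : List (ZMod 4)) : Extension

/-- The data of a labelled rooted map with extension. -/
structure LabelledMap : Type where
  /-- the number of darts -/
  size : ℕ
  /-- the next dart, counterclockwise, at the same vertex -/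
  rot : Equiv.Perm (Fin size)
  /-- the other half of the same edge; a dart is fixed when its edge ends at a leaf or at the
  root, on the boundary of the disk -/
  opp : Equiv.Perm (Fin size)
  /-- the dart whose edge ends at the root -/
  root : Fin size
  /-- the label of the sector immediately to the right of the dart (oriented away from its
  vertex), that is, of the sector between `rot⁻¹ h` and `h` -/
  label : Fin size → ZMod 4
  /-- the extension data -/
  ext : Extension

namespace LabelledMap

variable (P : LabelledMap)

/-- The face permutation: walk along the edge of the dart `h` away from its vertex (turning back
if the edge ends on the boundary), and at the vertex reached take the next dart counterclockwise, so
that the face stays on the right. The cycles are the faces of the map on the sphere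
obtained by gluing a disk to the outside; all regions which meet the boundary of the
disk together form one cycle. -/
def face : Equiv.Perm (Fin P.size) := P.opp.trans P.rot

/-- The edge of `h` ends on the boundary of the disk. -/
def IsLeg (h : Fin P.size) : Prop := P.opp h = h

instance (h : Fin P.size) : Decidable (P.IsLeg h) :=
  inferInstanceAs (Decidable (P.opp h = h))

/-- The number of cycles (including fixed points) of a permutation. -/
noncomputable def numCycles {n : ℕ} (f : Equiv.Perm (Fin n)) : ℕ :=
  Nat.card (Quotient (Equiv.Perm.SameCycle.setoid f))

/-- The number `d` of `4`-valent vertices. -/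
noncomputable def numVertices : ℕ := numCycles P.rot

/-- The number of edges, including those ending on the boundary (the `2`-valent vertices of an
extended pattern, which merely subdivide the root edge, are disregarded). -/
noncomputable def numEdges : ℕ := numCycles P.opp

/-- The number of faces, those which meet the boundary of the disk being counted as one (in the
sphere obtained by gluing a disk to the outside). -/
noncomputable def numFaces : ℕ := numCycles P.face

/-- The number of univalent vertices on the boundary of the disk (root included). -/
noncomputable def numLegs : ℕ := Nat.card {h : Fin P.size // P.IsLeg h}

/-- The weight: the first Betti number `1 - χ(Γ)` of the (connected) graph. -/
noncomputable def weight : ℤ := 1 + P.numEdges - (P.numVertices + P.numLegs)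

/-- The darts `face r, face² r, …, r`, where `r` is the root dart: these are the darts whose
right sectors are adjacent to the boundary, in the order in which they are met when the
boundary of the disk is traversed, in the positive (counterclockwise) direction, from the root. -/
noncomputable def boundaryDarts : List (Fin P.size) :=
  (List.range (Function.minimalPeriod P.face P.root)).map fun k => (P.face ^ (k + 1)) P.root

/-- The labels of the quadrants visible along the successive boundary intervals; an interval
ends when a dart is met whose edge ends on the boundary. -/
noncomputable def quadrantWords : List (List (ZMod 4)) :=
  (P.boundaryDarts.splitBy fun h _ => ! decide (P.IsLeg h)).map fun l => l.map P.label

/-- The labels of all distinguished sectors visible along the successive boundary intervals. -/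
noncomputable def sectorWords : List (List (ZMod 4)) :=
  match P.ext with
  | .centered => P.quadrantWords
  | .left l => P.quadrantWords.modifyHead fun t => l ++ t
  | .right l => P.quadrantWords.modifyLast fun t => t ++ l

/-- The chord sequence `ρ¹ ⊗ ⋯ ⊗ ρⁿ`, as a list. -/
noncomputable def chordSequence : List (Option Basic) := P.sectorWords.map chordProd

/-- The output element: `U^d` times the left idempotent of the first quadrant (centered case),
or times the product of the chords of the distinguished `2`-valent sectors (extended case). -/
noncomputable def output : Alg :=
  match P.ext with
  | .centered => elt P.numVertices (.idem (source (P.label (P.face P.root))))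
  | .left l => eltOpt P.numVertices (chordProd l)
  | .right l => eltOpt P.numVertices (chordProd l)

/-- The labels on the extension continue the valid labelling: along the root edge, labels to
the right of a direction of travel increase by one. -/
def ValidExtension : Prop :=
  match P.ext with
  | .centered => True
  | .left l => l ≠ [] ∧ (l ++ [P.label (P.face P.root)]).IsChain fun a b => a + 1 = b
  | .right l => l ≠ [] ∧ (P.label P.root :: l).IsChain fun a b => a + 1 = b

/-- The map is a (centered or extended) tiling pattern. -/
structure IsTilingPattern : Prop where
  /-- `opp` pairs the two halves of each edge. -/
  opp_opp : ∀ h, P.opp (P.opp h) = h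
  /-- Every internal vertex has valence `4`. -/
  valence : ∀ h, Function.minimalPeriod P.rot h = 4
  /-- The edge of the root dart ends on the boundary. -/
  root_leg : P.IsLeg P.root
  /-- The graph is connected. -/
  connected : ∀ h, Relation.ReflTransGen (fun a b => b = P.rot a ∨ b = P.opp a) P.root h
  /-- The map is planar: Euler's formula on the sphere. -/
  planar : P.numVertices + P.numLegs + P.numFaces = P.numEdges + 2
  /-- All leaves lie on the boundary of the disk, i.e. in one common face of the sphere. -/
  legs_outer : ∀ h, P.IsLeg h → P.face.SameCycle P.root h
  /-- Every face which does not meet the boundary of the disk is a short cycle: it meets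
  exactly four vertices and four edges. -/
  short_cycle : ∀ h, ¬ P.face.SameCycle P.root h →
    Function.minimalPeriod P.face h = 4 ∧
      ∀ h', P.face.SameCycle h h' → h' ≠ h → ¬ P.rot.SameCycle h h' ∧ P.opp h ≠ h'
  /-- Counterclockwise around every vertex the labels are `4, 3, 2, 1` up to cyclic order. -/
  label_rot : ∀ h, P.label (P.rot h) = P.label h - 1
  /-- For an internal edge, oriented from the vertex of `h` to the other end, the
  labels to its right increase by one. -/
  label_opp : ∀ h, ¬ P.IsLeg h → P.label (P.rot (P.opp h)) = P.label h + 1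
  /-- The labels of the extension are valid. -/
  ext_valid : P.ValidExtension

end LabelledMap

/-- Tiling patterns (on a standard set of darts). -/
abbrev TilingPattern : Type := {P : LabelledMap // P.IsTilingPattern}

/-- Isomorphism of tiling patterns: a bijection of darts preserving all the structure.
This is orientation-preserving homeomorphism of the disk, respecting graph, root and labels. -/
def TilingPattern.Iso (P Q : TilingPattern) : Prop :=
  ∃ f : Fin P.1.size ≃ Fin Q.1.size,
    (∀ h, f (P.1.rot h) = Q.1.rot (f h)) ∧ (∀ h, f (P.1.opp h) = Q.1.opp (f h)) ∧
    f P.1.root = Q.1.root ∧ (∀ h, Q.1.label (f h) = P.1.label h) ∧ P.1.ext = Q.1.ext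

/-- Isomorphism as an equivalence relation. -/
def TilingPattern.setoid : Setoid TilingPattern where
  r := TilingPattern.Iso
  iseqv :=
    { refl := fun _ => ⟨Equiv.refl _, fun _ => rfl, fun _ => rfl, rfl, fun _ => rfl, rfl⟩
      symm := by
        rintro P Q ⟨f, h1, h2, h3, h4, h5⟩
        refine ⟨f.symm, fun h => ?_, fun h => ?_, ?_, fun h => ?_, h5.symm⟩
        · rw [Equiv.symm_apply_eq, h1, Equiv.apply_symm_apply]
        · rw [Equiv.symm_apply_eq, h2, Equiv.apply_symm_apply]
        · rw [Equiv.symm_apply_eq, h3]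
        · rw [← h4, Equiv.apply_symm_apply]
      trans := by
        rintro P Q R ⟨f, h1, h2, h3, h4, h5⟩ ⟨g, k1, k2, k3, k4, k5⟩
        exact ⟨f.trans g, fun h => by simp [h1, k1], fun h => by simp [h2, k2],
          by simp [h3, k3], fun h => by simp [h4, k4], h5.trans k5⟩ }

/-- Isomorphism classes of tiling patterns. -/
abbrev TilingClass : Type := Quotient TilingPattern.setoid

/-- A labelled map representing an isomorphism class. Chord sequence, weight and output element
are isomorphism invariants, so the choice of the representative is irrelevant. -/
noncomputable def TilingClass.rep (c : TilingClass) : LabelledMap := (Quotient.out c).1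

/-! ## The operations -/

/-- Sum of the output elements of all (isomorphism classes of) tiling patterns of weight `w`
with a given chord sequence. There are only finitely many: with `n` chords the Euler characteristic
gives `d = w + n/2 - 1`, which bounds the size, and the chords bound the lengths of extensions. -/
noncomputable def tilingSum (n w : ℕ) (b : Fin n → Basic) : Alg :=
  ∑ᶠ c ∈ {c : TilingClass | c.rep.weight = w ∧ c.rep.chordSequence = (List.ofFn b).map some},
    c.rep.output

open Classical in
/-- The operation `μ_n^w` on basic elements. -/
noncomputable def muBasic : (n w : ℕ) → (Fin n → Basic) → Alg
  | 0, w, _ => if w = 1 then ∑ i : ZMod 4, elt 0 (.reeb i 3) else 0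
  | 2, 0, b => eltOpt 0 ((b 0).mul (b 1))
  | n, w, b => if ∃ i x, b i = .idem x then 0 else tilingSum n w b

/-- The operation `μ_n^w` of the weighted algebra: the `𝔽₂[U]`-multilinear extension of its values on
basic elements. -/
noncomputable def mu (n w : ℕ) (a : Fin n → Alg) : Alg :=
  ∑ b ∈ Fintype.piFinset fun i => (a i).support, (∏ i, a i (b i)) • muBasic n w b

/-! ## Gradings by groups -/

open Classical in
/-- A `(Γ, λ_d, λ_w)`-grading: a decomposition `A = ⨁ A_g` into sub-bimodules over the ground ring
spanned by the idempotents `e x`, such that `μ_n^w` is graded of degree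
`λ_d^{n-2} λ_w^w`, with `λ_d` and `λ_w` central. -/
structure IsGrading {X A Γ : Type*} [AddCommGroup A] [Module (ZMod 2) A] [Group Γ]
    (μ : (n w : ℕ) → (Fin n → A) → A) (e : X → A) (ld lw : Γ)
    (piece : Γ → Submodule (ZMod 2) A) : Prop where
  central_d : ld ∈ Subgroup.center Γ
  central_w : lw ∈ Subgroup.center Γ
  decomposition : DirectSum.IsInternal piece
  ground_left : ∀ x g, ∀ a ∈ piece g, μ 2 0 ![e x, a] ∈ piece g
  ground_right : ∀ x g, ∀ a ∈ piece g, μ 2 0 ![a, e x] ∈ piece g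
  homogeneous : ∀ (n w : ℕ) (g : Fin n → Γ) (a : Fin n → A), (∀ i, a i ∈ piece (g i)) →
    μ n w a ∈ piece (ld ^ ((n : ℤ) - 2) * lw ^ w * (List.ofFn g).prod)

/-- The homogeneous piece of degree `g` for an assignment of degrees to the elements `U^k b`:
the span of those `U^k b` that have degree `g`. -/
noncomputable def piece {Γ : Type*} (gr : ℕ → Basic → Γ) (g : Γ) : Submodule (ZMod 2) Alg :=
  Submodule.span (ZMod 2) {x | ∃ k b, gr k b = g ∧ x = elt k b}

/-! ## The big grading group -/

/-- Quintuples `(m; a, b, c, d)`. -/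
@[ext] structure Quintuple : Type where
  m : ℚ
  a : ℤ
  b : ℤ
  c : ℤ
  d : ℤ
  deriving DecidableEq

namespace Quintuple

instance : Mul Quintuple where
  mul g h :=
    ⟨g.m + h.m + (1 / 2) * (g.a * h.b - g.b * h.a) + (1 / 2) * (g.b * h.c - g.c * h.b)
        + (1 / 2) * (g.c * h.d - g.d * h.c) + (1 / 2) * (g.d * h.a - g.a * h.d),
      g.a + h.a, g.b + h.b, g.c + h.c, g.d + h.d⟩

instance : One Quintuple := ⟨⟨0, 0, 0, 0, 0⟩⟩

instance : Inv Quintuple := ⟨fun g => ⟨-g.m, -g.a, -g.b, -g.c, -g.d⟩⟩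

theorem mul_def (g h : Quintuple) : g * h =
    ⟨g.m + h.m + (1 / 2) * (g.a * h.b - g.b * h.a) + (1 / 2) * (g.b * h.c - g.c * h.b)
        + (1 / 2) * (g.c * h.d - g.d * h.c) + (1 / 2) * (g.d * h.a - g.a * h.d),
      g.a + h.a, g.b + h.b, g.c + h.c, g.d + h.d⟩ := rfl

theorem one_def : (1 : Quintuple) = ⟨0, 0, 0, 0, 0⟩ := rfl

theorem inv_def (g : Quintuple) : g⁻¹ = ⟨-g.m, -g.a, -g.b, -g.c, -g.d⟩ := rfl

instance : Group Quintuple :=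
  Group.ofLeftAxioms
    (fun x y z => by
      simp only [mul_def, Quintuple.mk.injEq]
      refine ⟨?_, by ring, by ring, by ring, by ring⟩
      push_cast
      ring)
    (fun x => by ext <;> simp [mul_def, one_def])
    (fun x => by
      simp only [mul_def, inv_def, one_def, Quintuple.mk.injEq]
      refine ⟨?_, by ring, by ring, by ring, by ring⟩
      push_cast
      ring)

end Quintuple

/-- The elements `(-1/2; e_i)`, for `i ∈ ℤ/4` (with `0` standing for `4`). -/
def bigGen (i : ZMod 4) : Quintuple :=
  ⟨-1 / 2, if i = 1 then 1 else 0, if i = 2 then 1 else 0, if i = 3 then 1 else 0,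
    if i = 0 then 1 else 0⟩

/-- The big grading group `G'`: the subgroup of the quintuples generated by
`λ = (1; 0, 0, 0, 0)` and the elements `(-1/2; e_i)`. -/
def bigSubgroup : Subgroup Quintuple :=
  Subgroup.closure (insert ⟨1, 0, 0, 0, 0⟩ (Set.range bigGen))

/-- The big grading group `G'`. -/
abbrev BigGroup : Type := bigSubgroup

/-- The multiplicity of `ρ_{i,…,i+n}` at the chord `ρ_j`. -/
def mult (i : ZMod 4) (n : ℕ) (j : ZMod 4) : ℤ :=
  ∑ k ∈ Finset.range (n + 1), if i + (k : ZMod 4) = j then 1 else 0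

/-- The degree of a Reeb element, as a quintuple: the support together with the
Maslov component `-(n+1)/4` if `4 ∣ n+1` and `-1/2 - ⌊(n+1)/4⌋` otherwise. -/
def reebDeg (i : ZMod 4) (n : ℕ) : Quintuple :=
  ⟨if 4 ∣ n + 1 then -((n + 1 : ℚ) / 4) else -1 / 2 - (((n + 1) / 4 : ℕ) : ℚ),
    mult i n 1, mult i n 2, mult i n 3, mult i n 0⟩

/-- The degree of a basic element, as a quintuple. -/
def basicDeg : Basic → Quintuple
  | .idem _ => ⟨0, 0, 0, 0, 0⟩
  | .reeb i n => reebDeg i n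

theorem mult_add_four (i : ZMod 4) (n : ℕ) (j : ZMod 4) : mult i (n + 4) j = mult i n j + 1 := by
  have h4 : (4 : ZMod 4) = 0 := by decide
  unfold mult
  rw [show n + 4 + 1 = 4 + (n + 1) by ring, Finset.sum_range_add, add_comm]
  congr 1
  · refine Finset.sum_congr rfl fun k _ => ?_
    push_cast
    rw [h4, zero_add]
  · revert i j
    decide

theorem reebDeg_add_four (i : ZMod 4) (n : ℕ) :
    reebDeg i (n + 4) = ⟨-1, 1, 1, 1, 1⟩ * reebDeg i n := by
  simp only [reebDeg, mult_add_four, Quintuple.mul_def, Quintuple.mk.injEq]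
  refine ⟨?_, by ring, by ring, by ring, by ring⟩
  have h1 : (4 ∣ n + 4 + 1) ↔ 4 ∣ n + 1 := by omega
  have h2 : (n + 4 + 1) / 4 = (n + 1) / 4 + 1 := by omega
  simp only [h1, h2]
  split_ifs <;> push_cast <;> ring

theorem bigGen_mem (i : ZMod 4) : bigGen i ∈ bigSubgroup :=
  Subgroup.subset_closure (Set.mem_insert_of_mem _ ⟨i, rfl⟩)

theorem lambda_mem : (⟨1, 0, 0, 0, 0⟩ : Quintuple) ∈ bigSubgroup :=
  Subgroup.subset_closure (Set.mem_insert _ _)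

theorem full_mem : (⟨-1, 1, 1, 1, 1⟩ : Quintuple) ∈ bigSubgroup := by
  have h : (⟨-1, 1, 1, 1, 1⟩ : Quintuple) = bigGen 1 * bigGen 2 * bigGen 3 * bigGen 0 := by
    decide +kernel
  rw [h]
  exact mul_mem (mul_mem (mul_mem (bigGen_mem _) (bigGen_mem _)) (bigGen_mem _)) (bigGen_mem _)

theorem lambdaW_mem : (⟨1, 1, 1, 1, 1⟩ : Quintuple) ∈ bigSubgroup := by
  have h : (⟨1, 1, 1, 1, 1⟩ : Quintuple) =
      ⟨1, 0, 0, 0, 0⟩ * ⟨1, 0, 0, 0, 0⟩ * ⟨-1, 1, 1, 1, 1⟩ := by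
    simp [Quintuple.mul_def]
  rw [h]
  exact mul_mem (mul_mem lambda_mem lambda_mem) full_mem

theorem reebDeg_mem (i : ZMod 4) : ∀ n, reebDeg i n ∈ bigSubgroup
  | 0 => by
    have h : reebDeg i 0 = bigGen i := by
      revert i
      decide +kernel
    rw [h]
    exact bigGen_mem i
  | 1 => by
    have h : reebDeg i 1 = bigGen i * bigGen (i + 1) := by
      revert i
      decide +kernel
    rw [h]
    exact mul_mem (bigGen_mem _) (bigGen_mem _)
  | 2 => by
    have h : reebDeg i 2 = bigGen i * bigGen (i + 1) * bigGen (i + 2) := by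
      revert i
      decide +kernel
    rw [h]
    exact mul_mem (mul_mem (bigGen_mem _) (bigGen_mem _)) (bigGen_mem _)
  | 3 => by
    have h : reebDeg i 3 = ⟨-1, 1, 1, 1, 1⟩ := by
      revert i
      decide +kernel
    rw [h]
    exact full_mem
  | n + 4 => by
    rw [reebDeg_add_four]
    exact mul_mem full_mem (reebDeg_mem i n)

theorem basicDeg_mem : ∀ b, basicDeg b ∈ bigSubgroup
  | .idem _ => one_mem bigSubgroup
  | .reeb i n => reebDeg_mem i n

/-- `λ_d = λ = (1; 0, 0, 0, 0)`. -/
def bigLambdaD : BigGroup := ⟨⟨1, 0, 0, 0, 0⟩, lambda_mem⟩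

/-- `λ_w = (1; 1, 1, 1, 1)`. -/
def bigLambdaW : BigGroup := ⟨⟨1, 1, 1, 1, 1⟩, lambdaW_mem⟩

/-- `gr'(U) = (-1; 1, 1, 1, 1)`. -/
def bigU : BigGroup := ⟨⟨-1, 1, 1, 1, 1⟩, full_mem⟩

/-- `gr'(U^k b) = gr'(U)^k gr'(b)`. -/
def grBig (k : ℕ) (b : Basic) : BigGroup := bigU ^ k * ⟨basicDeg b, basicDeg_mem b⟩

/-! ## The intermediate grading group -/

/-- Triples `(m; a, b)`. -/
@[ext] structure Triple : Type where
  m : ℚ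
  a : ℚ
  b : ℚ

namespace Triple

instance : Mul Triple where
  mul g h := ⟨g.m + h.m + g.a * h.b - g.b * h.a, g.a + h.a, g.b + h.b⟩

instance : One Triple := ⟨⟨0, 0, 0⟩⟩

instance : Inv Triple := ⟨fun g => ⟨-g.m, -g.a, -g.b⟩⟩

theorem mul_def (g h : Triple) :
    g * h = ⟨g.m + h.m + g.a * h.b - g.b * h.a, g.a + h.a, g.b + h.b⟩ := rfl

theorem one_def : (1 : Triple) = ⟨0, 0, 0⟩ := rfl

theorem inv_def (g : Triple) : g⁻¹ = ⟨-g.m, -g.a, -g.b⟩ := rfl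

instance : Group Triple :=
  Group.ofLeftAxioms
    (fun x y z => by
      simp only [mul_def, Triple.mk.injEq]
      refine ⟨by ring, by ring, by ring⟩)
    (fun x => by ext <;> simp [mul_def, one_def])
    (fun x => by
      simp only [mul_def, inv_def, one_def, Triple.mk.injEq]
      refine ⟨by ring, by ring, by ring⟩)

end Triple

/-- The rational number `x` is an integer. -/
def IsInt (x : ℚ) : Prop := ∃ k : ℤ, x = k

/-- The intermediate grading group `G`: all `(m; a, b) ∈ (½ℤ)³` with `a + b ∈ ℤ` and
`m + ((2a+1)(a+b+1)+1)/2 ∈ ℤ`. -/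
def interSubgroup : Subgroup Triple where
  carrier := {g | IsInt (2 * g.m) ∧ IsInt (2 * g.a) ∧ IsInt (2 * g.b) ∧ IsInt (g.a + g.b) ∧
    IsInt (g.m + ((2 * g.a + 1) * (g.a + g.b + 1) + 1) / 2)}
  one_mem' := by
    refine ⟨⟨0, ?_⟩, ⟨0, ?_⟩, ⟨0, ?_⟩, ⟨0, ?_⟩, ⟨1, ?_⟩⟩ <;> simp [Triple.one_def]
  mul_mem' := by
    rintro ⟨m, a, b⟩ ⟨n, c, d⟩ ⟨⟨p1, h1⟩, ⟨p2, h2⟩, ⟨p3, h3⟩, ⟨p4, h4⟩, ⟨p5, h5⟩⟩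
      ⟨⟨q1, k1⟩, ⟨q2, k2⟩, ⟨q3, k3⟩, ⟨q4, k4⟩, ⟨q5, k5⟩⟩
    simp only [Triple.mul_def] at *
    refine ⟨⟨p1 + q1 + p2 * q4 - p4 * q2, ?_⟩, ⟨p2 + q2, ?_⟩, ⟨p3 + q3, ?_⟩, ⟨p4 + q4, ?_⟩,
      ⟨p5 + q5 + p2 * q4 - 1, ?_⟩⟩ <;> push_cast <;>
      simp only [← h1, ← h2, ← h3, ← h4, ← h5, ← k1, ← k2, ← k3, ← k4, ← k5] <;> ring
  inv_mem' := by
    rintro ⟨m, a, b⟩ ⟨⟨p1, h1⟩, ⟨p2, h2⟩, ⟨p3, h3⟩, ⟨p4, h4⟩, ⟨p5, h5⟩⟩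
    simp only [Triple.inv_def] at *
    refine ⟨⟨-p1, ?_⟩, ⟨-p2, ?_⟩, ⟨-p3, ?_⟩, ⟨-p4, ?_⟩, ⟨2 - p5 + p2 * p4, ?_⟩⟩ <;> push_cast <;>
      simp only [← h1, ← h2, ← h3, ← h4, ← h5] <;> ring

/-- The intermediate grading group `G`. -/
abbrev InterGroup : Type := interSubgroup

/-- The homomorphism `(j; a, b, c, d) ↦ (j - d; (a+b-c-d)/2, (-a+b+c-d)/2)` on quintuples. -/
def quintupleToTriple : Quintuple →* Triple where
  toFun g := ⟨g.m - g.d, (g.a + g.b - g.c - g.d) / 2, (-g.a + g.b + g.c - g.d) / 2⟩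
  map_one' := by simp [Quintuple.one_def, Triple.one_def]
  map_mul' g h := by
    simp only [Quintuple.mul_def, Triple.mul_def, Triple.mk.injEq]
    push_cast
    refine ⟨by ring, by ring, by ring⟩

theorem quintupleToTriple_mem {g : Quintuple} (hg : g ∈ bigSubgroup) :
    quintupleToTriple g ∈ interSubgroup := by
  have h : bigSubgroup ≤ interSubgroup.comap quintupleToTriple := by
    refine (Subgroup.closure_le _).2 ?_
    rintro x (rfl | ⟨i, rfl⟩)
    · refine ⟨⟨2, ?_⟩, ⟨0, ?_⟩, ⟨0, ?_⟩, ⟨0, ?_⟩, ⟨2, ?_⟩⟩ <;> norm_num [quintupleToTriple]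
    · have hi : i = 1 ∨ i = 2 ∨ i = 3 ∨ i = 0 := by revert i; decide
      rcases hi with rfl | rfl | rfl | rfl
      · refine ⟨⟨-1, ?_⟩, ⟨1, ?_⟩, ⟨-1, ?_⟩, ⟨0, ?_⟩, ⟨1, ?_⟩⟩ <;> decide +kernel
      · refine ⟨⟨-1, ?_⟩, ⟨1, ?_⟩, ⟨1, ?_⟩, ⟨1, ?_⟩, ⟨2, ?_⟩⟩ <;> decide +kernel
      · refine ⟨⟨-1, ?_⟩, ⟨-1, ?_⟩, ⟨1, ?_⟩, ⟨0, ?_⟩, ⟨0, ?_⟩⟩ <;> decide +kernel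
      · refine ⟨⟨-3, ?_⟩, ⟨-1, ?_⟩, ⟨-1, ?_⟩, ⟨-1, ?_⟩, ⟨-1, ?_⟩⟩ <;> decide +kernel
  exact h hg

/-- The homomorphism `G' → G`. -/
def bigToInter : BigGroup →* InterGroup :=
  (quintupleToTriple.comp bigSubgroup.subtype).codRestrict interSubgroup
    fun g => quintupleToTriple_mem g.2

/-- The `G`-valued degree induced by the homomorphism `G' → G`. -/
def grInter (k : ℕ) (b : Basic) : InterGroup := bigToInter (grBig k b)

/-! ## The small grading group -/

/-- The small grading group `G(𝕋) = {(m; a, b) ∈ G ∣ a, b ∈ ℤ}`. -/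
def smallSubgroup : Subgroup InterGroup where
  carrier := {g | IsInt g.1.a ∧ IsInt g.1.b}
  one_mem' := ⟨⟨0, by simp [Triple.one_def]⟩, ⟨0, by simp [Triple.one_def]⟩⟩
  mul_mem' := by
    rintro g h ⟨⟨p, hp⟩, ⟨q, hq⟩⟩ ⟨⟨r, hr⟩, ⟨s, hs⟩⟩
    exact ⟨⟨p + r, by simp [Triple.mul_def, hp, hr]⟩, ⟨q + s, by simp [Triple.mul_def, hq, hs]⟩⟩
  inv_mem' := by
    rintro g ⟨⟨p, hp⟩, ⟨q, hq⟩⟩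
    exact ⟨⟨-p, by simp [Triple.inv_def, hp]⟩, ⟨-q, by simp [Triple.inv_def, hq]⟩⟩

/-- The small grading group `G(𝕋)`. -/
abbrev SmallGroup : Type := smallSubgroup

/-- The grading refinement data, with base idempotent `ι₀`: `ψ(ι₀) = 1`, `ψ(ι₁) = gr(ρ₁)`. -/
def psi (x : Fin 2) : InterGroup := if x = 0 then 1 else grInter 0 (.reeb 1 0)

/-- The refined degree `gr_ψ(a) = ψ(x) gr(a) ψ(y)⁻¹` of an element `a = ι_x a ι_y`. -/
def refinedDeg (k : ℕ) (b : Basic) : InterGroup := psi b.left * grInter k b * (psi b.right)⁻¹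

theorem mult_succ (i : ZMod 4) (n : ℕ) (j : ZMod 4) :
    mult i (n + 1) j = mult i n j + if i + (n : ZMod 4) + 1 = j then 1 else 0 := by
  unfold mult
  rw [Finset.sum_range_succ]
  push_cast
  rw [add_assoc]

theorem reeb_parity (i : ZMod 4) (n : ℕ) : ∃ k : ℤ,
    mult i n 1 + mult i n 2 - mult i n 3 - mult i n 0 =
      2 * k + ((source i : ℕ) : ℤ) + ((source (i + n + 1) : ℕ) : ℤ) := by
  induction n with
  | zero =>
    have h : ∀ i : ZMod 4, mult i 0 1 + mult i 0 2 - mult i 0 3 - mult i 0 0 =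
        2 * (if i = 1 ∨ i = 2 then 0 else -1) + ((source i : ℕ) : ℤ) +
          ((source (i + 1) : ℕ) : ℤ) := by decide
    exact ⟨_, by rw [Nat.cast_zero, add_zero]; exact h i⟩
  | succ n ih =>
    obtain ⟨k, hk⟩ := ih
    have h : ∀ j : ZMod 4, ∃ l ∈ ({-1, 0, 1} : Finset ℤ),
        (if j = 1 then 1 else 0) + (if j = 2 then 1 else 0) - (if j = 3 then 1 else 0) -
          (if j = 0 then 1 else 0) =
        2 * l + ((source (j + 1) : ℕ) : ℤ) - ((source j : ℕ) : ℤ) := by decide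
    obtain ⟨l, -, hl⟩ := h (i + n + 1)
    refine ⟨k + l, ?_⟩
    simp only [mult_succ]
    push_cast
    rw [← add_assoc i]
    linarith

theorem grInter_parity (k : ℕ) (b : Basic) : ∃ l : ℤ,
    (grInter k b).1.a = l + (((b.left : ℕ) : ℚ) + ((b.right : ℕ) : ℚ)) / 2 := by
  induction k with
  | zero =>
    have h0 : (grInter 0 b).1 = quintupleToTriple (basicDeg b) := by
      simp [grInter, grBig, bigToInter]
    rw [h0]
    cases b with
    | idem x =>
      refine ⟨-(x : ℕ), ?_⟩
      simp [quintupleToTriple, basicDeg, Basic.left, Basic.right]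
    | reeb i n =>
      obtain ⟨k, hk⟩ := reeb_parity i n
      refine ⟨k, ?_⟩
      have hq : (mult i n 1 : ℚ) + mult i n 2 - mult i n 3 - mult i n 0 =
        2 * k + ((source i : ℕ) : ℚ) + ((source (i + n + 1) : ℕ) : ℚ) := by exact_mod_cast hk
      simp only [quintupleToTriple, basicDeg, reebDeg, Basic.left, Basic.right, MonoidHom.coe_mk,
        OneHom.coe_mk, hq]
      ring
  | succ k ih =>
    have h : grInter (k + 1) b = bigToInter bigU * grInter k b := by
      rw [grInter, grInter, ← map_mul, grBig, grBig, pow_succ', mul_assoc]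
    have hU : (bigToInter bigU).1.a = 0 := by
      simp [bigToInter, bigU, quintupleToTriple]
    rw [h]
    simpa [Triple.mul_def, hU] using ih

theorem psi_parity (x : Fin 2) : ∃ l : ℤ, (psi x).1.a = l + ((x : ℕ) : ℚ) / 2 := by
  by_cases hx : x = 0
  · exact ⟨0, by simp [psi, hx, Triple.one_def]⟩
  · obtain ⟨l, hl⟩ := grInter_parity 0 (.reeb 1 0)
    have h1 : x = 1 := by omega
    refine ⟨l, ?_⟩
    have e1 : source 1 = 0 := by decide
    have e2 : source (1 + 1) = 1 := by decide
    simpa [psi, h1, Basic.left, Basic.right, e1, e2] using hl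

theorem refinedDeg_mem (k : ℕ) (b : Basic) : refinedDeg k b ∈ smallSubgroup := by
  have ha : IsInt (refinedDeg k b).1.a := by
    obtain ⟨p, hp⟩ := psi_parity b.left
    obtain ⟨q, hq⟩ := psi_parity b.right
    obtain ⟨r, hr⟩ := grInter_parity k b
    refine ⟨p + r - q + (b.left : ℕ), ?_⟩
    simp only [refinedDeg, Subgroup.coe_mul, Subgroup.coe_inv, Triple.mul_def, Triple.inv_def,
      hp, hq, hr]
    push_cast
    ring
  refine ⟨ha, ?_⟩
  obtain ⟨p, hp⟩ := ha
  obtain ⟨-, -, -, ⟨q, hq⟩, -⟩ := (refinedDeg k b).2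
  exact ⟨q - p, by push_cast; linarith⟩

/-- The refined `G(𝕋)`-valued degree. -/
def grSmall (k : ℕ) (b : Basic) : SmallGroup := ⟨refinedDeg k b, refinedDeg_mem k b⟩

/-- The element `λ = (1; 0, 0)` of `G`. -/
def interLambdaD : InterGroup :=
  ⟨⟨1, 0, 0⟩, ⟨2, by norm_num⟩, ⟨0, by norm_num⟩, ⟨0, by norm_num⟩, ⟨0, by norm_num⟩,
    ⟨2, by norm_num⟩⟩

/-- The element `λ = (1; 0, 0)` of `G(𝕋)`. -/
def smallLambdaD : SmallGroup :=
  ⟨interLambdaD, ⟨0, by simp [interLambdaD]⟩, ⟨0, by simp [interLambdaD]⟩⟩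

end TorusAlgebra

open TorusAlgebra

/-! Everything reduces to one identity for a tiling pattern with n boundary intervals, d vertices
and weight w: if T is the product of the degrees of the single chords seen along the boundary, then
λ_d^(n-2) λ_w^w T = gr'(U)^d (`big_boundary`). Degrees are multiplicative on the path algebra, so
the degrees of the chord sequence multiply to T, multiplied on one side by the degree of the output
chord if the pattern is extended. As λ_d, λ_w and gr'(U) are central, the identity gives homogeneity
of all tiling operations; `isGrading_of_boundary` carries this out for an arbitrary group.

To compute T, read the labels 1, 2, 3, 4 as unit steps east, north, west, south. The twisting term
of G' is half the determinant of the vectors (a-c, b-d), so the Maslov component of a product of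
generators is -1/2 per factor plus the signed area swept by the lattice path. Labels decrease around
a vertex, which gives a clockwise unit square, and increase around an inner face, which gives a
counterclockwise one. A planar connected map has no first cohomology, so the corners develop
consistently into the plane (`exists_potential`, `exists_development`). The sum of x dy - y dx over
all corners can then be taken vertex by vertex or face by face, and comparing the two gives the area
enclosed by the boundary word (`prod_bigGen`). Euler's formula converts the numbers of legs and
faces into d and w.

The grading by G follows by applying the homomorphism. For G(𝕋), the factors ψ cancel between
consecutive boundary chords, so T is only conjugated, which is harmless because the boundary
identity makes T central. -/

namespace TorusAlgebra

open LabelledMap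

/-! ### Cycle sums of permutations and exactness on planar maps -/

section Cycles

variable {n : ℕ}

theorem sum_cycle {M : Type*} [AddCommMonoid M] (f : Equiv.Perm (Fin n)) (g : Fin n → M)
    (h : Fin n) [DecidablePred (f.SameCycle h)] :
    ∑ x with f.SameCycle h x, g x =
      ∑ k ∈ Finset.range (Function.minimalPeriod f h), g ((f ^ k) h) := by
  have hpos : 0 < Function.minimalPeriod f h :=
    Function.minimalPeriod_pos_of_mem_periodicPts (f.injective.mem_periodicPts h)
  have himg : Finset.univ.filter (f.SameCycle h) =
      (Finset.range (Function.minimalPeriod f h)).image fun k => (f ^ k) h := by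
    ext x
    simp only [Finset.mem_filter, Finset.mem_univ, true_and, Finset.mem_image, Finset.mem_range]
    constructor
    · intro hx
      obtain ⟨i, hi⟩ := hx.exists_nat_pow_eq
      refine ⟨i % Function.minimalPeriod f h, Nat.mod_lt _ hpos, ?_⟩
      rw [← hi, Equiv.Perm.coe_pow, Equiv.Perm.coe_pow, Function.iterate_mod_minimalPeriod_eq]
    · rintro ⟨k, -, rfl⟩
      exact ⟨k, by simp⟩
  rw [himg, Finset.sum_image]
  intro i hi j hj hij
  simp only [Finset.coe_range, Set.mem_Iio] at hi hj
  simp only [Equiv.Perm.coe_pow] at hij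
  exact Function.iterate_injOn_Iio_minimalPeriod hi hj hij

/-- If the sum of `g` is `c` along every cycle but that of `r`, these cycles contribute `c` each
to the total sum. -/
theorem sum_eq_sum_cycle_add (f : Equiv.Perm (Fin n)) (g : Fin n → ℚ) (r : Fin n) (c : ℚ)
    (hc : ∀ h, ¬ f.SameCycle r h →
      ∑ k ∈ Finset.range (Function.minimalPeriod f h), g ((f ^ k) h) = c) :
    ∑ h, g h = ∑ k ∈ Finset.range (Function.minimalPeriod f r), g ((f ^ k) r) +
      ((numCycles f : ℚ) - 1) * c := by
  classical
  let s := Equiv.Perm.SameCycle.setoid f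
  have hq : ∀ q : Quotient s, q ≠ ⟦r⟧ →
      ∑ x with (⟦x⟧ : Quotient s) = q, g x = c := by
    intro q
    induction q using Quotient.inductionOn with
    | h y =>
      intro hy
      rw [← hc y fun h => hy (Quotient.sound h.symm), ← sum_cycle f g y]
      refine Finset.sum_congr (Finset.filter_congr fun x _ => ?_) fun _ _ => rfl
      exact Quotient.eq.trans ⟨fun h => h.symm, fun h => h.symm⟩
  have hr : ∑ x with (⟦x⟧ : Quotient s) = ⟦r⟧, g x =
      ∑ k ∈ Finset.range (Function.minimalPeriod f r), g ((f ^ k) r) := by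
    rw [← sum_cycle f g r]
    refine Finset.sum_congr (Finset.filter_congr fun x _ => ?_) fun _ _ => rfl
    exact Quotient.eq.trans ⟨fun h => h.symm, fun h => h.symm⟩
  rw [← Finset.sum_fiberwise Finset.univ (fun x => (⟦x⟧ : Quotient s)) g,
    ← Finset.add_sum_erase _ _ (Finset.mem_univ (⟦r⟧ : Quotient s)), hr,
    Finset.sum_congr rfl fun q hq' => hq q (Finset.ne_of_mem_erase hq'), Finset.sum_const,
    Finset.card_erase_of_mem (Finset.mem_univ _), nsmul_eq_mul, Finset.card_univ,
    ← Nat.card_eq_fintype_card, Nat.cast_sub]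
  · simp [numCycles, s]
  · exact Nat.card_pos_iff.2 ⟨⟨⟦r⟧⟩, inferInstance⟩

theorem sum_eq_numCycles_mul (f : Equiv.Perm (Fin n)) (g : Fin n → ℚ) (r : Fin n) (c : ℚ)
    (hc : ∀ h, ∑ k ∈ Finset.range (Function.minimalPeriod f h), g ((f ^ k) h) = c) :
    ∑ h, g h = numCycles f * c := by
  rw [sum_eq_sum_cycle_add f g r c fun h _ => hc h, hc]
  ring

/-- On a connected map of genus zero, a function on the corners whose sums around all vertices and
all faces vanish is the difference of a function on the edges. -/
theorem exists_potential (σ α : Equiv.Perm (Fin n)) (r : Fin n)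
    (hconn : ∀ p : Fin n → ℚ, (∀ h, p (σ h) = p h) → (∀ h, p (α h) = p h) → ∀ h, p h = p r)
    (euler : numCycles σ + numCycles α + numCycles (α.trans σ) = n + 2) (f : Fin n → ℚ)
    (hσ : ∀ h, ∑ k ∈ Finset.range (Function.minimalPeriod σ h), f ((σ ^ k) h) = 0)
    (hφ : ∀ h, ∑ k ∈ Finset.range (Function.minimalPeriod (α.trans σ) h),
      f (((α.trans σ) ^ k) h) = 0) :
    ∃ p : Fin n → ℚ, (∀ h, p (α h) = p h) ∧ ∀ h, f (σ h) = p (σ h) - p h := by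
  classical
  let φ : Equiv.Perm (Fin n) := α.trans σ
  let Q (τ : Equiv.Perm (Fin n)) := Quotient (Equiv.Perm.SameCycle.setoid τ)
  have proj_eq : ∀ (τ : Equiv.Perm (Fin n)) h, (⟦τ h⟧ : Q τ) = ⟦h⟧ := fun τ h =>
    Quotient.sound (show τ.SameCycle (τ h) h from ⟨-1, by simp⟩)
  let B : Matrix (Q σ ⊕ Q φ) (Fin n) ℚ := fun q h =>
    q.elim (fun q => if (⟦h⟧ : Q σ) = q then 1 else 0) (fun q => if (⟦h⟧ : Q φ) = q then 1 else 0)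
  have cycSum : ∀ (τ : Equiv.Perm (Fin n)) (g : Fin n → ℚ) (y : Fin n),
      ∑ h, (if (⟦h⟧ : Q τ) = ⟦y⟧ then 1 else 0) * g h =
        ∑ k ∈ Finset.range (Function.minimalPeriod τ y), g ((τ ^ k) y) := by
    intro τ g y
    rw [← sum_cycle τ g y, Finset.sum_filter]
    refine Finset.sum_congr rfl fun x _ => ?_
    have : ((⟦x⟧ : Q τ) = ⟦y⟧) ↔ τ.SameCycle y x :=
      Quotient.eq.trans ⟨fun h => h.symm, fun h => h.symm⟩
    simp [this]
  have memKer : ∀ g : Fin n → ℚ, g ∈ LinearMap.ker B.mulVecLin ↔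
      (∀ y, ∑ k ∈ Finset.range (Function.minimalPeriod σ y), g ((σ ^ k) y) = 0) ∧
      (∀ y, ∑ k ∈ Finset.range (Function.minimalPeriod φ y), g ((φ ^ k) y) = 0) := by
    intro g
    rw [LinearMap.mem_ker, funext_iff, Sum.forall]
    refine and_congr ?_ ?_
    · rw [Quotient.forall]
      exact forall_congr' fun y => by rw [← cycSum σ g y]; rfl
    · rw [Quotient.forall]
      exact forall_congr' fun y => by rw [← cycSum φ g y]; rfl
  -- A vector in this kernel is a function on vertices and a function on faces that cancel at every
  -- corner. Both are then invariant under `σ` and `φ`, hence under `α`, and connectedness makes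
  -- them constant.
  have kerTr : Module.finrank ℚ (LinearMap.ker B.transpose.mulVecLin) ≤ 1 := by
    have key : ∀ a ∈ LinearMap.ker B.transpose.mulVecLin, ∀ h,
        a (Sum.inl ⟦h⟧) = a (Sum.inl ⟦r⟧) ∧ a (Sum.inr ⟦h⟧) = - a (Sum.inl ⟦r⟧) := by
      intro a ha
      have h0 : ∀ h, a (Sum.inl (⟦h⟧ : Q σ)) + a (Sum.inr (⟦h⟧ : Q φ)) = 0 := by
        intro h
        have : ∑ q, B q h * a q = 0 := congrFun (LinearMap.mem_ker.1 ha) h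
        rw [Fintype.sum_sum_type, Fintype.sum_eq_single (⟦h⟧ : Q σ) fun q hq => by
            simp [B, hq.symm], Fintype.sum_eq_single (⟦h⟧ : Q φ) fun q hq => by
            simp [B, hq.symm]] at this
        simpa [B] using this
      have h1 : ∀ h, a (Sum.inl (⟦σ h⟧ : Q σ)) = a (Sum.inl (⟦h⟧ : Q σ)) := fun h => by
        rw [proj_eq]
      have h2 : ∀ h, a (Sum.inl (⟦φ h⟧ : Q σ)) = a (Sum.inl (⟦h⟧ : Q σ)) := fun h => by
        have e1 := h0 (φ h)
        have e2 := h0 h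
        rw [proj_eq φ h] at e1
        linarith
      have h3 := hconn (fun h => a (Sum.inl (⟦h⟧ : Q σ))) h1 fun h => by
        rw [← h1 (α h)]
        exact h2 h
      intro h
      refine ⟨h3 h, ?_⟩
      have := h0 h
      rw [← h3 h]
      linarith
    by_cases hz : ∀ a ∈ LinearMap.ker B.transpose.mulVecLin, a (Sum.inl ⟦r⟧) = 0
    · have : LinearMap.ker B.transpose.mulVecLin = ⊥ := by
        rw [eq_bot_iff]
        intro a ha
        rw [Submodule.mem_bot]
        funext q
        rcases q with q | q
        · induction q using Quotient.inductionOn with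
          | h y => rw [(key a ha y).1, hz a ha]; rfl
        · induction q using Quotient.inductionOn with
          | h y => rw [(key a ha y).2, hz a ha]; simp
      rw [this]
      simp
    · push Not at hz
      obtain ⟨b, hb, hb0⟩ := hz
      refine finrank_le_one ⟨b, hb⟩ fun a => ⟨a.1 (Sum.inl ⟦r⟧) / b (Sum.inl ⟦r⟧), ?_⟩
      ext q
      rcases q with q | q
      · induction q using Quotient.inductionOn with
        | h y =>
          simp only [SetLike.val_smul, Pi.smul_apply, smul_eq_mul]
          rw [(key b hb y).1, (key a.1 a.2 y).1]
          field_simp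
      · induction q using Quotient.inductionOn with
        | h y =>
          simp only [SetLike.val_smul, Pi.smul_apply, smul_eq_mul]
          rw [(key b hb y).2, (key a.1 a.2 y).2]
          field_simp
  let T : (Q α → ℚ) →ₗ[ℚ] (Fin n → ℚ) :=
    { toFun := fun p h => p ⟦h⟧ - p ⟦σ.symm h⟧
      map_add' := fun p q => by ext h; simp only [Pi.add_apply]; ring
      map_smul' := fun c p => by
        ext h
        simp only [Pi.smul_apply, smul_eq_mul, RingHom.id_apply]
        ring }
  -- A function on edges with zero differences around vertices is constant, again by connectedness.
  have kerT : Module.finrank ℚ (LinearMap.ker T) ≤ 1 := by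
    refine finrank_le_one ⟨fun _ => 1, ?_⟩ fun p => ⟨p.1 ⟦r⟧, ?_⟩
    · rw [LinearMap.mem_ker]
      ext h
      simp [T]
    · have hp := LinearMap.mem_ker.1 p.2
      have hcst := hconn (fun h => p.1 ⟦h⟧) (fun h => by
        have := congrFun hp (σ h)
        simp only [T, LinearMap.coe_mk, AddHom.coe_mk, Equiv.symm_apply_apply,
          Pi.zero_apply] at this
        linarith) (fun h => by simp only [proj_eq α h])
      ext q
      induction q using Quotient.inductionOn with
      | h y => simpa using (hcst y).symm
  have rangeT : LinearMap.range T ≤ LinearMap.ker B.mulVecLin := by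
    rintro _ ⟨p, rfl⟩
    have tele : ∀ (τ : Equiv.Perm (Fin n)) (_ : ∀ h, T p h = p ⟦h⟧ - p ⟦τ.symm h⟧) (y : Fin n),
        ∑ k ∈ Finset.range (Function.minimalPeriod τ y), T p ((τ ^ k) y) = 0 := by
      intro τ hτ y
      have step : ∀ m, ∑ k ∈ Finset.range m, T p ((τ ^ k) y) =
          p ⟦τ.symm ((τ ^ m) y)⟧ - p ⟦τ.symm y⟧ := by
        intro m
        induction m with
        | zero => simp
        | succ m ih =>
          rw [Finset.sum_range_succ, ih, hτ, pow_succ', Equiv.Perm.mul_apply,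
            Equiv.symm_apply_apply]
          ring
      rw [step, Equiv.Perm.coe_pow, Function.iterate_minimalPeriod]
      ring
    refine (memKer _).2 ⟨tele σ fun h => rfl, tele φ fun h => ?_⟩
    -- `σ.symm h` and `φ.symm h` are exchanged by `α`, so `T p` is a difference along `φ` as well as
    -- along `σ`, and telescopes around faces too.
    have : (⟦σ.symm h⟧ : Q α) = ⟦φ.symm h⟧ := by
      rw [← proj_eq α (φ.symm h)]
      congr 1
      simp [φ]
    rw [← this]
    rfl
  have e0 : numCycles σ + numCycles α + numCycles φ = n + 2 := euler
  have e1 := LinearMap.finrank_range_add_finrank_ker B.mulVecLin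
  have e2 := LinearMap.finrank_range_add_finrank_ker B.transpose.mulVecLin
  have e3 := LinearMap.finrank_range_add_finrank_ker T
  have e4 : Module.finrank ℚ (LinearMap.range B.transpose.mulVecLin) =
      Module.finrank ℚ (LinearMap.range B.mulVecLin) := Matrix.rank_transpose B
  have c : ∀ τ : Equiv.Perm (Fin n), numCycles τ = Fintype.card (Q τ) := fun τ =>
    Nat.card_eq_fintype_card
  simp only [Module.finrank_fintype_fun_eq_card, Fintype.card_sum, Fintype.card_fin, ← c]
    at e1 e2 e3
  -- With V, E, F the numbers of cycles of `σ`, `α`, `φ`, the rank of `B` is at least V + F - 1, so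
  -- its kernel has dimension at most n - V - F + 1 = E - 1, while the range of `T` has dimension at
  -- least E - 1.
  have heq := Submodule.eq_of_le_of_finrank_le rangeT (by omega)
  obtain ⟨p, hp⟩ : f ∈ LinearMap.range T := by
    rw [heq]
    exact (memKer f).2 ⟨hσ, hφ⟩
  refine ⟨fun h => p ⟦h⟧, fun h => by simp only [proj_eq α h], fun h => ?_⟩
  rw [← hp]
  simp [T]

end Cycles

/-! ### Unit squares in the lattice and arithmetic of quintuples -/

theorem sum_sub_eq_sum (g : ZMod 4 → ℚ) (i : ZMod 4) :
    ∑ k ∈ Finset.range 4, g (i - (k : ZMod 4)) = ∑ j, g j := by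
  have h : ∀ i : ZMod 4, ((Finset.range 4).image fun k : ℕ => i - (k : ZMod 4)) = Finset.univ := by
    decide
  have h' : ∀ i : ZMod 4, Set.InjOn (fun k : ℕ => i - (k : ZMod 4)) (Finset.range 4) := by
    intro i a ha b hb hab
    simp only [Finset.coe_range, Set.mem_Iio] at ha hb
    have : (a : ZMod 4) = b := sub_right_injective hab
    rw [ZMod.natCast_eq_natCast_iff'] at this
    omega
  rw [← h i, Finset.sum_image (h' i)]

theorem sum_add_eq_sum (g : ZMod 4 → ℚ) (i : ZMod 4) :
    ∑ k ∈ Finset.range 4, g (i + (k : ZMod 4)) = ∑ j, g j := by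
  rw [← Equiv.sum_comp (Equiv.neg (ZMod 4)) g, ← sum_sub_eq_sum _ (-i)]
  refine Finset.sum_congr rfl fun k _ => ?_
  simp only [Equiv.neg_apply]
  congr 1
  ring

/-- The horizontal component of the direction of travel along a corner with a given label, in the
square lattice. -/
def dirX (j : ZMod 4) : ℚ := if j = 1 then 1 else if j = 3 then -1 else 0

/-- The vertical component of the direction of travel along a corner with a given label. -/
def dirY (j : ZMod 4) : ℚ := if j = 2 then 1 else if j = 0 then -1 else 0

theorem sum_dirX : ∑ j, dirX j = 0 := by decide +kernel

theorem sum_dirY : ∑ j, dirY j = 0 := by decide +kernel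

/-- The signed area of a closed lattice path around a unit square, counterclockwise. -/
theorem area_counterclockwise (i : ZMod 4) (x y : ℕ → ℚ)
    (hx : ∀ k, x (k + 1) = x k + dirX (i + k)) (hy : ∀ k, y (k + 1) = y k + dirY (i + k)) :
    ∑ k ∈ Finset.range 4, (x k * dirY (i + k) - y k * dirX (i + k)) = 2 := by
  have hi : i = 0 ∨ i = 1 ∨ i = 2 ∨ i = 3 := by clear hx hy; revert i; decide
  have e1 : (2 : ZMod 4) + 2 = 0 := by decide
  have e2 : (3 : ZMod 4) + 1 = 0 := by decide
  have e3 : (3 : ZMod 4) + 2 = 1 := by decide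
  have e4 : (3 : ZMod 4) + 3 = 2 := by decide
  have e5 : (2 : ZMod 4) + 3 = 1 := by decide
  have e6 : (2 : ZMod 4) + 1 = 3 := by decide
  have e7 : (1 : ZMod 4) + 1 = 2 := by decide
  have e8 : (1 : ZMod 4) + 2 = 3 := by decide
  have e9 : (1 : ZMod 4) + 3 = 0 := by decide
  have v : dirX 0 = 0 ∧ dirX 1 = 1 ∧ dirX 2 = 0 ∧ dirX 3 = -1 ∧
      dirY 0 = -1 ∧ dirY 1 = 0 ∧ dirY 2 = 1 ∧ dirY 3 = 0 := by decide +kernel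
  obtain ⟨v1, v2, v3, v4, v5, v6, v7, v8⟩ := v
  rcases hi with rfl | rfl | rfl | rfl <;>
  simp [Finset.sum_range_succ, hx, hy, e1, e2, e3, e4, e5, e6, e7, e8, e9, v1, v2, v3, v4, v5,
    v6, v7, v8] <;> ring

/-- The signed area of a closed lattice path around a unit square, clockwise. -/
theorem area_clockwise (i : ZMod 4) (x y : ℕ → ℚ)
    (hx : ∀ k, x (k + 1) = x k + dirX (i - k)) (hy : ∀ k, y (k + 1) = y k + dirY (i - k)) :
    ∑ k ∈ Finset.range 4, (x k * dirY (i - k) - y k * dirX (i - k)) = -2 := by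
  have hi : i = 0 ∨ i = 1 ∨ i = 2 ∨ i = 3 := by clear hx hy; revert i; decide
  have e1 : (2 : ZMod 4) - 1 = 1 := by decide
  have e2 : (3 : ZMod 4) - 1 = 2 := by decide
  have e3 : (3 : ZMod 4) - 2 = 1 := by decide
  have e4 : (2 : ZMod 4) - 3 = 3 := by decide
  have e5 : (1 : ZMod 4) - 2 = 3 := by decide
  have e6 : (1 : ZMod 4) - 3 = 2 := by decide
  have e7 : -(1 : ZMod 4) = 3 := by decide
  have e8 : -(2 : ZMod 4) = 2 := by decide
  have e9 : -(3 : ZMod 4) = 1 := by decide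
  have v : dirX 0 = 0 ∧ dirX 1 = 1 ∧ dirX 2 = 0 ∧ dirX 3 = -1 ∧
      dirY 0 = -1 ∧ dirY 1 = 0 ∧ dirY 2 = 1 ∧ dirY 3 = 0 := by decide +kernel
  obtain ⟨v1, v2, v3, v4, v5, v6, v7, v8⟩ := v
  rcases hi with rfl | rfl | rfl | rfl <;>
  simp [Finset.sum_range_succ, hx, hy, e1, e2, e3, e4, e5, e6, e7, e8, e9, v1, v2, v3, v4, v5,
    v6, v7, v8] <;> ring

/-- The twisting form is the determinant (a-c)(b'-d') - (b-d)(a'-c'), and the generator with label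
`j` has difference vector (`dirX j`, `dirY j`). Multiplying by generators thus accumulates area
along a lattice path. -/
theorem Quintuple.mul_bigGen (g : Quintuple) (j : ZMod 4) :
    g * bigGen j = ⟨g.m - 1 / 2 + 1 / 2 * ((g.a - g.c) * dirY j - (g.b - g.d) * dirX j),
      g.a + if j = 1 then 1 else 0, g.b + if j = 2 then 1 else 0,
      g.c + if j = 3 then 1 else 0, g.d + if j = 0 then 1 else 0⟩ := by
  have hj : j = 0 ∨ j = 1 ∨ j = 2 ∨ j = 3 := by revert j; decide
  have v : dirX 0 = 0 ∧ dirX 1 = 1 ∧ dirX 2 = 0 ∧ dirX 3 = -1 ∧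
      dirY 0 = -1 ∧ dirY 1 = 0 ∧ dirY 2 = 1 ∧ dirY 3 = 0 := by decide +kernel
  obtain ⟨v1, v2, v3, v4, v5, v6, v7, v8⟩ := v
  have d : (0 : ZMod 4) ≠ 1 ∧ (0 : ZMod 4) ≠ 2 ∧ (0 : ZMod 4) ≠ 3 ∧ (1 : ZMod 4) ≠ 2 ∧
    (1 : ZMod 4) ≠ 3 ∧ (2 : ZMod 4) ≠ 3 := by decide
  obtain ⟨d1, d2, d3, d4, d5, d6⟩ := d
  rcases hj with rfl | rfl | rfl | rfl <;>
  simp [Quintuple.mul_def, bigGen, v1, v2, v3, v4, v5, v6, v7, v8, d1, d2, d3, d4, d5, d6,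
    d1.symm, d2.symm, d3.symm, d4.symm, d5.symm, d6.symm] <;> ring

theorem Quintuple.diag_zpow (x : ℚ) (y k : ℤ) :
    (⟨x, y, y, y, y⟩ : Quintuple) ^ k = ⟨k * x, k * y, k * y, k * y, k * y⟩ := by
  induction k with
  | zero => simp [Quintuple.one_def]
  | succ k ih =>
    rw [zpow_add_one, ih, Quintuple.mul_def]
    ext <;> push_cast <;> ring
  | pred k ih =>
    rw [zpow_sub_one, ih, Quintuple.inv_def, Quintuple.mul_def]
    ext <;> push_cast <;> ring

/-- Diagonal quintuples have a-c = b-d = 0, so the twisting form vanishes on them. This covers λ_d,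
λ_w and gr'(U). -/
theorem Quintuple.diag_comm (x : ℚ) (y : ℤ) (g : Quintuple) :
    (⟨x, y, y, y, y⟩ : Quintuple) * g = g * ⟨x, y, y, y, y⟩ := by
  rw [Quintuple.mul_def, Quintuple.mul_def]
  ext <;> push_cast <;> ring

/-! ### The boundary word of a tiling pattern -/

namespace LabelledMap.IsTilingPattern

variable {P : LabelledMap} (hP : P.IsTilingPattern)
include hP

theorem opp_eq_or (h : Fin P.size) :
    P.IsLeg h ∧ Function.minimalPeriod P.opp h = 1 ∨
      ¬ P.IsLeg h ∧ Function.minimalPeriod P.opp h = 2 := by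
  by_cases hl : P.IsLeg h
  · exact Or.inl ⟨hl, Function.minimalPeriod_eq_one_iff_isFixedPt.2 hl⟩
  · exact Or.inr ⟨hl, Function.minimalPeriod_eq_prime (hp := ⟨Nat.prime_two⟩)
      (hP.opp_opp h) hl⟩

theorem size_eq : (P.size : ℚ) = 4 * P.numVertices := by
  have := sum_eq_numCycles_mul P.rot (fun _ => 1) P.root 4 fun h => by simp [hP.valence]
  simp only [Finset.sum_const, Finset.card_univ, Fintype.card_fin, nsmul_eq_mul, mul_one] at this
  rw [this, mul_comm]
  rfl

omit hP in
theorem numLegs_eq : (P.numLegs : ℚ) = ∑ h, if P.IsLeg h then 1 else 0 := by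
  rw [numLegs, Nat.card_eq_fintype_card, Fintype.card_subtype, Finset.sum_boole]

theorem size_add_numLegs : (P.size : ℚ) + P.numLegs = 2 * P.numEdges := by
  have := sum_eq_numCycles_mul P.opp (fun h => 1 + if P.IsLeg h then 1 else 0) P.root 2
    fun h => by
      rcases hP.opp_eq_or h with ⟨h1, h2⟩ | ⟨h1, h2⟩
      · simp [h2, h1]
        norm_num
      · have h3 : ¬ P.IsLeg (P.opp h) := fun e => h1 (P.opp.injective e)
        simp [h2, h1, h3, Finset.sum_range_succ]
        norm_num
  rw [Finset.sum_add_distrib, ← numLegs_eq] at this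
  simp only [Finset.sum_const, Finset.card_univ, Fintype.card_fin, nsmul_eq_mul, mul_one] at this
  rw [this, mul_comm]
  rfl

theorem planar_rat :
    (P.numVertices : ℚ) + P.numLegs + P.numFaces = P.numEdges + 2 := by
  exact_mod_cast hP.planar

theorem euler : numCycles P.rot + numCycles P.opp + numCycles P.face = P.size + 2 := by
  have h1 := hP.planar_rat
  have h2 := hP.size_add_numLegs
  have h3 : (P.numVertices : ℚ) + P.numEdges + P.numFaces = P.size + 2 := by linarith
  exact_mod_cast h3

/-- Counting darts by vertices and by edges leaves, with Euler's formula and the definition of the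
weight, only the parameters d and w. In particular the weight is the number of inner faces. -/
theorem numLegs_add (w : ℕ) (hw : P.weight = w) :
    (P.numLegs : ℚ) + 2 * w = 2 * P.numVertices + 2 ∧ (P.numFaces : ℚ) = w + 1 := by
  have h1 := hP.planar_rat
  have h2 := hP.size_add_numLegs
  have h3 := hP.size_eq
  have h4 : (1 : ℚ) + P.numEdges - (P.numVertices + P.numLegs) = w := by
    have : ((P.weight : ℤ) : ℚ) = w := by exact_mod_cast hw
    rw [← this, weight]
    push_cast
    ring
  constructor <;> linarith

theorem label_rot_pow (h : Fin P.size) (k : ℕ) :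
    P.label ((P.rot ^ k) h) = P.label h - k := by
  induction k with
  | zero => simp
  | succ k ih =>
    rw [pow_succ', Equiv.Perm.mul_apply, hP.label_rot, ih]
    push_cast
    ring

/-- All legs lie on the outer face, so the rule along internal edges applies at every step of an
inner face. -/
theorem label_face_pow {h : Fin P.size} (hh : ¬ P.face.SameCycle P.root h) (k : ℕ) :
    P.label ((P.face ^ k) h) = P.label h + k := by
  induction k with
  | zero => simp
  | succ k ih =>
    have hl : ¬ P.IsLeg ((P.face ^ k) h) := fun hl =>
      hh (Equiv.Perm.sameCycle_pow_right.1 (hP.legs_outer _ hl))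
    rw [pow_succ', Equiv.Perm.mul_apply]
    refine (hP.label_opp _ hl).trans ?_
    rw [ih]
    push_cast
    ring

theorem sum_vertex (g : ZMod 4 → ℚ) (h : Fin P.size) :
    ∑ k ∈ Finset.range (Function.minimalPeriod P.rot h), g (P.label ((P.rot ^ k) h)) =
      ∑ j, g j := by
  simp only [hP.valence, hP.label_rot_pow, sum_sub_eq_sum]

theorem sum_inner_face (g : ZMod 4 → ℚ) {h : Fin P.size} (hh : ¬ P.face.SameCycle P.root h) :
    ∑ k ∈ Finset.range (Function.minimalPeriod P.face h), g (P.label ((P.face ^ k) h)) =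
      ∑ j, g j := by
  simp only [(hP.short_cycle h hh).1, hP.label_face_pow hh, sum_add_eq_sum]

/-- Each corner belongs to one vertex and one face, and every vertex and every inner face shows each
label once. The outer face carries the difference. -/
theorem sum_outer_face (g : ZMod 4 → ℚ) :
    ∑ k ∈ Finset.range (Function.minimalPeriod P.face P.root), g (P.label ((P.face ^ k) P.root)) =
      (P.numVertices - (P.numFaces - 1)) * ∑ j, g j := by
  have h1 := sum_eq_numCycles_mul P.rot (fun h => g (P.label h)) P.root _ (hP.sum_vertex g)
  have h2 := sum_eq_sum_cycle_add P.face (fun h => g (P.label h)) P.root _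
    fun h hh => hP.sum_inner_face g hh
  have h3 : numCycles P.rot = P.numVertices := rfl
  have h4 : numCycles P.face = P.numFaces := rfl
  rw [h3] at h1
  rw [h4] at h2
  linarith

theorem eq_of_invariant {p : Fin P.size → ℚ} (h1 : ∀ h, p (P.rot h) = p h)
    (h2 : ∀ h, p (P.opp h) = p h) (h : Fin P.size) : p h = p P.root := by
  have h3 := hP.connected h
  induction h3 with
  | refl => rfl
  | tail _ hbc ih =>
    rcases hbc with rfl | rfl
    · rw [h1, ih]
    · rw [h2, ih]

/-- A function of the labels with sum zero is integrated along the corners of a tiling pattern. -/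
theorem exists_development (g : ZMod 4 → ℚ) (hg : ∑ j, g j = 0) :
    ∃ p : Fin P.size → ℚ, (∀ h, p (P.opp h) = p h) ∧
      ∀ h, p (P.rot h) = p h + g (P.label (P.rot h)) := by
  obtain ⟨p, h1, h2⟩ := exists_potential P.rot P.opp P.root (fun p => hP.eq_of_invariant) hP.euler
    (fun h => g (P.label h)) (fun h => (hP.sum_vertex g h).trans hg) fun h => by
      by_cases hh : P.face.SameCycle P.root h
      · classical
        have := hP.sum_outer_face g
        rw [← sum_cycle P.face (fun h => g (P.label h)), hg, mul_zero] at this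
        refine Eq.trans (sum_cycle P.face (fun h => g (P.label h)) h).symm (Eq.trans ?_ this)
        refine Finset.sum_congr (Finset.filter_congr fun x _ => ?_) fun _ _ => rfl
        exact ⟨fun h => hh.trans h, fun h => hh.symm.trans h⟩
      · exact (hP.sum_inner_face g hh).trans hg
  exact ⟨p, h1, fun h => by rw [h2 h]; ring⟩

/-- The product of the degrees of the quadrants visible from the boundary of a tiling pattern. -/
theorem prod_bigGen :
    (P.boundaryDarts.map fun h => bigGen (P.label h)).prod =
      ⟨(P.numFaces - 1) - 3 * P.numVertices, P.numVertices - (P.numFaces - 1),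
        P.numVertices - (P.numFaces - 1), P.numVertices - (P.numFaces - 1),
        P.numVertices - (P.numFaces - 1)⟩ := by
  obtain ⟨x, hx1, hx2⟩ := hP.exists_development dirX sum_dirX
  obtain ⟨y, hy1, hy2⟩ := hP.exists_development dirY sum_dirY
  have hx3 : ∀ h, x (P.face h) = x h + dirX (P.label (P.face h)) := fun h => by
    rw [← hx1 h]; exact hx2 _
  have hy3 : ∀ h, y (P.face h) = y h + dirY (P.label (P.face h)) := fun h => by
    rw [← hy1 h]; exact hy2 _
  let B : Fin P.size → ℚ := fun h =>
    x h * dirY (P.label (P.rot h)) - y h * dirX (P.label (P.rot h))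
  let C : Fin P.size → ℚ := fun h =>
    x h * dirY (P.label (P.face h)) - y h * dirX (P.label (P.face h))
  -- Since `face h = rot (opp h)` and the coordinates are invariant under `opp`, `C` is `B` composed
  -- with `opp`; this compares summation by faces with summation by vertices.
  have hBC : ∑ h, C h = ∑ h, B h := by
    rw [← Equiv.sum_comp P.opp B]
    refine Finset.sum_congr rfl fun h _ => ?_
    simp only [B, C, hx1, hy1]
    rfl
  -- The form x dy - y dx measures twice the area, so a clockwise unit square contributes -2; an
  -- inner face will contribute 2.
  have hB := sum_eq_numCycles_mul P.rot B P.root (-2) fun h => by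
    rw [hP.valence]
    have key := area_clockwise (P.label (P.rot h)) (fun k => x ((P.rot ^ k) h))
      (fun k => y ((P.rot ^ k) h))
      (fun k => by
        rw [pow_succ', Equiv.Perm.mul_apply, hx2, ← Equiv.Perm.mul_apply, ← pow_succ',
          pow_succ, Equiv.Perm.mul_apply, hP.label_rot_pow])
      (fun k => by
        rw [pow_succ', Equiv.Perm.mul_apply, hy2, ← Equiv.Perm.mul_apply, ← pow_succ',
          pow_succ, Equiv.Perm.mul_apply, hP.label_rot_pow])
    rw [← key]
    refine Finset.sum_congr rfl fun k _ => ?_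
    simp only [B]
    rw [← Equiv.Perm.mul_apply P.rot, ← pow_succ', pow_succ, Equiv.Perm.mul_apply,
      hP.label_rot_pow]
  have hC := sum_eq_sum_cycle_add P.face C P.root 2 fun h hh => by
    have hh' : ¬ P.face.SameCycle P.root (P.face h) := fun e =>
      hh (Equiv.Perm.sameCycle_apply_right.1 e)
    rw [(hP.short_cycle h hh).1]
    have key := area_counterclockwise (P.label (P.face h)) (fun k => x ((P.face ^ k) h))
      (fun k => y ((P.face ^ k) h))
      (fun k => by
        rw [pow_succ', Equiv.Perm.mul_apply, hx3, ← Equiv.Perm.mul_apply, ← pow_succ',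
          pow_succ, Equiv.Perm.mul_apply, hP.label_face_pow hh'])
      (fun k => by
        rw [pow_succ', Equiv.Perm.mul_apply, hy3, ← Equiv.Perm.mul_apply, ← pow_succ',
          pow_succ, Equiv.Perm.mul_apply, hP.label_face_pow hh'])
    rw [← key]
    refine Finset.sum_congr rfl fun k _ => ?_
    simp only [C]
    rw [← Equiv.Perm.mul_apply P.face, ← pow_succ', pow_succ, Equiv.Perm.mul_apply,
      hP.label_face_pow hh']
  have hV : numCycles P.rot = P.numVertices := rfl
  have hF : numCycles P.face = P.numFaces := rfl
  rw [hV] at hB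
  rw [hF] at hC
  -- For partial products the Maslov component is -1/2 per step plus the area seen from the starting
  -- point. The last term corrects for the coordinates of `P.root`, which need not be at the origin;
  -- it vanishes once the path closes up.
  have step : ∀ m : ℕ,
      let Q := ((List.range m).map fun k => bigGen (P.label ((P.face ^ (k + 1)) P.root))).prod
      (Q.a : ℚ) = ∑ k ∈ Finset.range m,
          (if P.label ((P.face ^ (k + 1)) P.root) = 1 then 1 else 0) ∧
      (Q.b : ℚ) = ∑ k ∈ Finset.range m,
          (if P.label ((P.face ^ (k + 1)) P.root) = 2 then 1 else 0) ∧
      (Q.c : ℚ) = ∑ k ∈ Finset.range m,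
          (if P.label ((P.face ^ (k + 1)) P.root) = 3 then 1 else 0) ∧
      (Q.d : ℚ) = ∑ k ∈ Finset.range m,
          (if P.label ((P.face ^ (k + 1)) P.root) = 0 then 1 else 0) ∧
      (Q.a : ℚ) - Q.c = x ((P.face ^ m) P.root) - x P.root ∧
      (Q.b : ℚ) - Q.d = y ((P.face ^ m) P.root) - y P.root ∧
      Q.m = - m / 2 + 1 / 2 * (∑ k ∈ Finset.range m, C ((P.face ^ k) P.root)) -
        1 / 2 * (x P.root * (y ((P.face ^ m) P.root) - y P.root) -
          y P.root * (x ((P.face ^ m) P.root) - x P.root)) := by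
    intro m
    induction m with
    | zero => simp [Quintuple.one_def]
    | succ m ih =>
      obtain ⟨i1, i2, i3, i4, i5, i6, i7⟩ := ih
      have dX : ∀ j : ZMod 4, dirX j = (if j = 1 then 1 else 0) - (if j = 3 then 1 else 0) := by
        decide +kernel
      have dY : ∀ j : ZMod 4, dirY j = (if j = 2 then 1 else 0) - (if j = 0 then 1 else 0) := by
        decide +kernel
      have ex : x ((P.face ^ (m + 1)) P.root) = x ((P.face ^ m) P.root) +
          dirX (P.label ((P.face ^ (m + 1)) P.root)) := by
        rw [pow_succ', Equiv.Perm.mul_apply, hx3]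
      have ey : y ((P.face ^ (m + 1)) P.root) = y ((P.face ^ m) P.root) +
          dirY (P.label ((P.face ^ (m + 1)) P.root)) := by
        rw [pow_succ', Equiv.Perm.mul_apply, hy3]
      have eC : C ((P.face ^ m) P.root) =
          x ((P.face ^ m) P.root) * dirY (P.label ((P.face ^ (m + 1)) P.root)) -
            y ((P.face ^ m) P.root) * dirX (P.label ((P.face ^ (m + 1)) P.root)) := by
        simp only [C]
        rw [← Equiv.Perm.mul_apply P.face, ← pow_succ']
      simp only [List.range_succ, List.map_append, List.prod_append, List.map_singleton,
        List.prod_singleton, Quintuple.mul_bigGen, Finset.sum_range_succ]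
      simp only [Int.cast_add, Int.cast_ite, Int.cast_one, Int.cast_zero]
      refine ⟨by rw [i1], by rw [i2], by rw [i3], by rw [i4], ?_, ?_, ?_⟩
      · rw [ex, dX]
        linarith
      · rw [ey, dY]
        linarith
      · rw [i7, i5, i6, ex, ey, eC]
        simp only [Nat.cast_add, Nat.cast_one]
        ring
  -- The boundary word starts at `face root` and ends at `root`; this cyclic shift by one does not
  -- change the sums.
  have shift : ∀ g : ZMod 4 → ℚ,
      ∑ k ∈ Finset.range (Function.minimalPeriod P.face P.root),
        g (P.label ((P.face ^ (k + 1)) P.root)) = (P.numVertices - (P.numFaces - 1)) * ∑ j, g j := by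
    intro g
    rw [← hP.sum_outer_face g]
    have := Finset.sum_range_succ' (fun k => g (P.label ((P.face ^ k) P.root)))
      (Function.minimalPeriod P.face P.root)
    rw [Finset.sum_range_succ] at this
    simp only [Equiv.Perm.coe_pow, Function.iterate_minimalPeriod, Function.iterate_zero,
      id] at this ⊢
    linarith
  obtain ⟨i1, i2, i3, i4, -, -, i7⟩ := step (Function.minimalPeriod P.face P.root)
  have hN := hP.sum_outer_face fun _ => 1
  rw [shift fun j => if j = 1 then 1 else 0] at i1
  rw [shift fun j => if j = 2 then 1 else 0] at i2
  rw [shift fun j => if j = 3 then 1 else 0] at i3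
  rw [shift fun j => if j = 0 then 1 else 0] at i4
  simp only [Finset.sum_const, Finset.card_range, nsmul_eq_mul, mul_one, Finset.card_univ,
    ZMod.card, Finset.sum_ite_eq', Finset.mem_univ, if_true] at hN i1 i2 i3 i4
  simp only [Equiv.Perm.coe_pow _ (Function.minimalPeriod P.face P.root),
    Function.iterate_minimalPeriod] at i7
  rw [boundaryDarts, List.map_map]
  refine Quintuple.ext ?_ ?_ ?_ ?_ ?_
  · refine i7.trans ?_
    push_cast at hN
    linarith
  · exact_mod_cast i1
  · exact_mod_cast i2
  · exact_mod_cast i3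
  · exact_mod_cast i4

/-- With F - 1 = w and n - 2 = 2d - 2w, the Maslov components add up to (2d - 2w) + w + (w - 3d) =
-d, and the other components to w + (d - w) = d. -/
theorem big_boundary (w : ℕ) (hw : P.weight = w) :
    (⟨1, 0, 0, 0, 0⟩ : Quintuple) ^ ((P.numLegs : ℤ) - 2) * ⟨1, 1, 1, 1, 1⟩ ^ w *
      (P.boundaryDarts.map fun h => bigGen (P.label h)).prod =
      ⟨-1, 1, 1, 1, 1⟩ ^ P.numVertices := by
  obtain ⟨h1, h2⟩ := hP.numLegs_add w hw
  have h3 : (P.numFaces : ℤ) = w + 1 := by exact_mod_cast h2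
  rw [hP.prod_bigGen, ← zpow_natCast, ← zpow_natCast, Quintuple.diag_zpow, Quintuple.diag_zpow,
    Quintuple.diag_zpow]
  simp only [Quintuple.mul_def, h2, h3]
  ext
  · push_cast
    linarith
  all_goals push_cast; ring

end LabelledMap.IsTilingPattern

/-! ### Cutting the boundary word into chords -/

section Lists

/-- A block closes exactly after an element satisfying `p`. The condition on the last element rules
out an unfinished block at the end. -/
theorem length_splitBy_not {α : Type*} (p : α → Bool) (l : List α)
    (hl : ∀ x ∈ l.getLast?, p x = true) :
    (l.splitBy fun a _ => ! p a).length = l.countP p := by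
  induction hn : l.length using Nat.strong_induction_on generalizing l with
  | _ n ih =>
    by_cases h0 : l = []
    · simp [h0]
    have hlast : p (l.getLast h0) = true := hl _ (by simp [List.getLast?_eq_some_getLast h0])
    -- The first block is `t` followed by the first element satisfying `p`; induction applies to the
    -- rest.
    set t := l.takeWhile fun a => ! p a with ht
    have hsplit := List.takeWhile_append_dropWhile (p := fun a => ! p a) (l := l)
    have htp : ∀ x ∈ t, p x = false := fun x hx => by
      simpa using List.mem_takeWhile_imp hx
    have hd : l.dropWhile (fun a => ! p a) ≠ [] := by
      intro h
      have := List.dropWhile_eq_nil_iff.1 h _ (List.getLast_mem h0)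
      simp [hlast] at this
    obtain ⟨a, m, ham⟩ := List.exists_cons_of_ne_nil hd
    have ha : p a = true := by
      have := List.head_dropWhile_not (fun a => ! p a) hd
      simpa [ham] using this
    rw [ham, ← ht] at hsplit
    have hchain : (t ++ [a]).IsChain fun x y => (! p x) = true := by
      rw [List.isChain_append]
      refine ⟨?_, List.isChain_singleton _, fun x hx y _ => ?_⟩
      · rw [List.isChain_iff_getElem]
        intro i hi
        simp [htp _ (List.getElem_mem _)]
      · simp [htp x (List.mem_of_getLast? hx)]
    have hcount : t.countP p = 0 := List.countP_eq_zero.2 fun x hx => by simp [htp x hx]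
    have hsplit' : l = (t ++ [a]) ++ m := by rw [← hsplit]; simp
    cases m with
    | nil =>
      rw [List.append_nil] at hsplit'
      rw [hsplit', List.splitBy_of_isChain (by simp) hchain]
      simp [hcount, ha]
    | cons b m =>
      rw [hsplit', List.splitBy_append_cons m (by simp [ha]),
        List.splitBy_of_isChain (by simp) hchain, List.length_append,
        ih (b :: m).length (by rw [← hn, hsplit']; simp; omega) (b :: m)
          (fun x hx => hl x (by rw [hsplit', List.getLast?_append, hx]; rfl)) rfl,
        List.countP_append]
      simp [hcount, ha]

theorem flatten_modifyHead {α : Type*} (l : List α) {L : List (List α)} (hL : L ≠ []) :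
    (L.modifyHead fun t => l ++ t).flatten = l ++ L.flatten := by
  cases L with
  | nil => exact absurd rfl hL
  | cons a L => simp

theorem flatten_modifyLast {α : Type*} (l : List α) {L : List (List α)} (hL : L ≠ []) :
    (L.modifyLast fun t => t ++ l).flatten = L.flatten ++ l := by
  rw [← List.dropLast_append_getLast hL, List.modifyLast_concat]
  simp

theorem length_modifyLast {α : Type*} (f : α → α) (L : List α) :
    (L.modifyLast f).length = L.length := by
  by_cases hL : L = []
  · subst hL
    rfl
  · rw [← List.dropLast_append_getLast hL, List.modifyLast_concat]
    simp

theorem countP_map_range {α : Type*} (p : α → Prop) [DecidablePred p] (f : ℕ → α) (m : ℕ) :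
    ((((List.range m).map f).countP fun a => decide (p a) : ℕ) : ℚ) =
      ∑ k ∈ Finset.range m, if p (f k) then 1 else 0 := by
  induction m with
  | zero => simp
  | succ m ih =>
    rw [List.range_succ, List.map_append, List.countP_append, Finset.sum_range_succ, ← ih]
    by_cases h : p (f m) <;> simp [h]

end Lists

namespace LabelledMap.IsTilingPattern

variable {P : LabelledMap} (hP : P.IsTilingPattern)
include hP

omit hP in
-- The exponents run from 1 to the period, so the last dart is the root; being a leg, it closes the
-- last interval.
theorem exists_boundaryDarts_eq (P : LabelledMap) : ∃ l, P.boundaryDarts = l ++ [P.root] := by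
  have hpos : 0 < Function.minimalPeriod P.face P.root :=
    Function.minimalPeriod_pos_of_mem_periodicPts (P.face.injective.mem_periodicPts _)
  obtain ⟨m, hm⟩ := Nat.exists_eq_succ_of_ne_zero hpos.ne'
  refine ⟨(List.range m).map fun k => (P.face ^ (k + 1)) P.root, ?_⟩
  have h : (P.face ^ (m + 1)) P.root = P.root := by
    rw [Equiv.Perm.coe_pow, ← Nat.succ_eq_add_one, ← hm, Function.iterate_minimalPeriod]
  rw [boundaryDarts, hm, Nat.succ_eq_add_one, List.range_succ, List.map_append]
  simp only [List.map_singleton, h]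

/-- Inner faces contain no legs, so the indicator of legs has cycle sum 0 away from the root. -/
theorem countP_boundaryDarts :
    (P.boundaryDarts.countP fun h => decide (P.IsLeg h)) = P.numLegs := by
  have h1 := sum_eq_sum_cycle_add P.face (fun h => if P.IsLeg h then 1 else 0) P.root 0
    fun h hh => Finset.sum_eq_zero fun k _ => if_neg fun hl =>
      hh (Equiv.Perm.sameCycle_pow_right.1 (hP.legs_outer _ hl))
  have h2 := Finset.sum_range_succ' (fun k => if P.IsLeg ((P.face ^ k) P.root) then (1 : ℚ) else 0)
    (Function.minimalPeriod P.face P.root)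
  rw [Finset.sum_range_succ] at h2
  have h3 : (P.face ^ Function.minimalPeriod P.face P.root) P.root = P.root := by
    rw [Equiv.Perm.coe_pow, Function.iterate_minimalPeriod]
  rw [h3, pow_zero, Equiv.Perm.one_apply, add_left_inj] at h2
  rw [← numLegs_eq, h2, mul_zero, add_zero] at h1
  have h4 := countP_map_range P.IsLeg (fun k => (P.face ^ (k + 1)) P.root)
    (Function.minimalPeriod P.face P.root)
  rw [← h1] at h4
  exact_mod_cast h4

theorem length_quadrantWords : P.quadrantWords.length = P.numLegs := by
  rw [quadrantWords, List.length_map, length_splitBy_not, hP.countP_boundaryDarts]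
  obtain ⟨l, hl⟩ := exists_boundaryDarts_eq P
  intro x hx
  rw [hl] at hx
  have : x = P.root := by simpa using hx.symm
  simpa [this] using hP.root_leg

omit hP in
theorem flatten_quadrantWords : P.quadrantWords.flatten = P.boundaryDarts.map P.label := by
  rw [quadrantWords, ← List.map_flatten, List.flatten_splitBy]

omit hP in
theorem quadrantWords_ne_nil : P.quadrantWords ≠ [] := by
  obtain ⟨l, hl⟩ := exists_boundaryDarts_eq P
  intro h
  have := flatten_quadrantWords (P := P)
  rw [h, hl] at this
  simp at this

theorem length_sectorWords : P.sectorWords.length = P.numLegs := by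
  rw [← hP.length_quadrantWords, sectorWords]
  split
  · rfl
  · simp
  · exact length_modifyLast _ _

end LabelledMap.IsTilingPattern

/-! ### The decomposition into homogeneous pieces -/

section Piece

variable {Γ : Type*} (gr : ℕ → Basic → Γ)

theorem elt_mem_piece (k : ℕ) (b : Basic) : elt k b ∈ piece gr (gr k b) :=
  Submodule.subset_span ⟨k, b, rfl, rfl⟩

/-- This recovers the degree of a homogeneous input from any monomial occurring in it. -/
theorem eq_of_coeff_ne_zero {g : Γ} {a : Alg} (ha : a ∈ piece gr g) {k : ℕ} {b : Basic}
    (h : (a b).coeff k ≠ 0) : gr k b = g := by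
  induction ha using Submodule.span_induction with
  | mem x hx =>
    obtain ⟨k', b', hg, rfl⟩ := hx
    by_cases hb : b' = b
    · subst hb
      rw [elt, Finsupp.single_eq_same, Polynomial.coeff_X_pow] at h
      have hk : k = k' := by
        by_contra hk
        exact h (if_neg hk)
      rw [hk, hg]
    · simp [elt, Finsupp.single_eq_of_ne (Ne.symm hb)] at h
  | zero => simp at h
  | add x y _ _ hx hy =>
    by_cases h1 : (x b).coeff k = 0
    · refine hy fun h2 => h ?_
      simp [h1, h2]
    · exact hx h1
  | smul c x _ hx =>
    refine hx fun h1 => h ?_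
    simp [h1]

/-- The basis of the elements `U^k b`. -/
noncomputable def eltBasis : Module.Basis (ℕ × Basic) (ZMod 2) Alg :=
  (Polynomial.basisMonomials (ZMod 2)).smulTower Finsupp.basisSingleOne

theorem eltBasis_apply (x : ℕ × Basic) : eltBasis x = elt x.1 x.2 := by
  rw [eltBasis, Module.Basis.smulTower_apply, elt]
  simp [Polynomial.monomial_one_right_eq_X_pow]

theorem piece_eq_span_image (g : Γ) :
    piece gr g = Submodule.span (ZMod 2) (eltBasis '' {x | gr x.1 x.2 = g}) := by
  rw [piece]
  congr 1
  ext x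
  constructor
  · rintro ⟨k, b, h, rfl⟩
    exact ⟨(k, b), h, eltBasis_apply _⟩
  · rintro ⟨⟨k, b⟩, h, rfl⟩
    exact ⟨k, b, h, eltBasis_apply _⟩

open Classical in
theorem isInternal_piece : DirectSum.IsInternal (piece gr) := by
  rw [DirectSum.isInternal_submodule_iff_iSupIndep_and_iSup_eq_top]
  constructor
  · rw [iSupIndep_def]
    intro g
    have h : (⨆ j, ⨆ (_ : j ≠ g), piece gr j) ≤
        Submodule.span (ZMod 2) (eltBasis '' {x | gr x.1 x.2 ≠ g}) := by
      refine iSup₂_le fun j hj => ?_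
      rw [piece_eq_span_image]
      refine Submodule.span_mono (Set.image_mono ?_)
      rintro x rfl
      exact hj
    refine Disjoint.mono_right h ?_
    rw [piece_eq_span_image]
    refine eltBasis.linearIndependent.disjoint_span_image ?_
    rw [Set.disjoint_left]
    exact fun x hx hx' => hx' hx
  · rw [eq_top_iff, ← eltBasis.span_eq, Submodule.span_le]
    rintro _ ⟨x, rfl⟩
    rw [eltBasis_apply]
    exact Submodule.mem_iSup_of_mem _ (elt_mem_piece gr x.1 x.2)

end Piece

/-! ### From degrees of basic elements to gradings -/

theorem exists_coeff_ne_zero_of_prod {ι R : Type*} [CommSemiring R] (s : Finset ι)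
    (q : ι → Polynomial R) {k : ℕ} (h : (∏ i ∈ s, q i).coeff k ≠ 0) :
    ∃ κ : ι → ℕ, ∑ i ∈ s, κ i = k ∧ ∀ i ∈ s, (q i).coeff (κ i) ≠ 0 := by
  classical
  induction s using Finset.induction_on generalizing k with
  | empty =>
    refine ⟨fun _ => 0, ?_, by simp⟩
    rw [Finset.prod_empty, Polynomial.coeff_one] at h
    by_contra hk
    exact h (if_neg fun e => hk (by simp [e]))
  | insert a s ha ih =>
    rw [Finset.prod_insert ha, Polynomial.coeff_mul] at h
    obtain ⟨⟨i, j⟩, hij, hne⟩ := Finset.exists_ne_zero_of_sum_ne_zero h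
    obtain ⟨κ, h1, h2⟩ := ih (right_ne_zero_of_mul hne)
    have hupd : ∀ x ∈ s, Function.update κ a i x = κ x := fun x hx =>
      Function.update_of_ne (fun e : x = a => ha (e ▸ hx)) _ _
    refine ⟨Function.update κ a i, ?_, fun x hx => ?_⟩
    · rw [Finset.sum_insert ha, Function.update_self, Finset.sum_congr rfl hupd, h1]
      exact Finset.HasAntidiagonal.mem_antidiagonal.1 hij
    · rcases Finset.mem_insert.1 hx with rfl | hx
      · rw [Function.update_self]
        exact left_ne_zero_of_mul hne
      · rw [hupd x hx]
        exact h2 x hx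

section Grading

variable {Γ : Type*} [Group Γ]

theorem prod_ofFn_pow_mul {u : Γ} (hu : u ∈ Subgroup.center Γ) {n : ℕ} (κ : Fin n → ℕ)
    (g : Fin n → Γ) :
    (List.ofFn fun i => u ^ κ i * g i).prod = u ^ (∑ i, κ i) * (List.ofFn g).prod := by
  induction n with
  | zero => simp
  | succ n ih =>
    have hc := Subgroup.mem_center_iff.1 (pow_mem hu (∑ i : Fin n, κ i.succ)) (g 0)
    rw [List.ofFn_succ, List.ofFn_succ, List.prod_cons, List.prod_cons, ih, Fin.sum_univ_succ,
      pow_add, mul_assoc, ← mul_assoc (g 0), hc]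
    simp only [mul_assoc]

variable (u ld lw : Γ) (deg : Basic → Γ)

/-- The degree of `U^k b`, from the degrees of `U` and of the basic elements. -/
abbrev extendDeg (k : ℕ) (b : Basic) : Γ := u ^ k * deg b

variable {u deg}

theorem smul_mem_piece {g g' : Γ} {x : Alg} (hx : x ∈ piece (extendDeg u deg) g)
    (q : Polynomial (ZMod 2)) (hq : ∀ k, q.coeff k ≠ 0 → u ^ k * g = g') :
    q • x ∈ piece (extendDeg u deg) g' := by
  rw [q.as_sum_support_C_mul_X_pow, Finset.sum_smul]
  refine Submodule.sum_mem _ fun k hk => ?_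
  rw [← Polynomial.smul_eq_C_mul, smul_assoc]
  refine Submodule.smul_mem _ _ ?_
  rw [← hq k (Polynomial.mem_support_iff.1 hk)]
  induction hx using Submodule.span_induction with
  | mem x hx =>
    obtain ⟨j, b, rfl, rfl⟩ := hx
    have h : (Polynomial.X ^ k : Polynomial (ZMod 2)) • elt j b = elt (k + j) b := by
      rw [elt, elt, Finsupp.smul_single, smul_eq_mul, pow_add]
    rw [h, ← mul_assoc, ← pow_add]
    exact elt_mem_piece (extendDeg u deg) (k + j) b
  | zero => rw [smul_zero]; exact zero_mem _
  | add x y _ _ hx hy => rw [smul_add]; exact add_mem hx hy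
  | smul c x _ hx => rw [smul_comm]; exact Submodule.smul_mem _ _ hx

theorem eltOpt_mem_piece (k : ℕ) (o : Option Basic) (g : Γ)
    (h : ∀ b, o = some b → u ^ k * deg b = g) : eltOpt k o ∈ piece (extendDeg u deg) g := by
  cases o with
  | none => exact zero_mem _
  | some b =>
    rw [← h b rfl]
    exact elt_mem_piece (extendDeg u deg) k b

/-- The word of a chord determines its degree, if the degree is multiplicative. -/
theorem deg_of_chordProd (hmul : ∀ b c e, b.mul c = some e → deg e = deg b * deg c) :
    ∀ (l : List (ZMod 4)) (b : Basic), chordProd l = some b →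
      deg b = (l.map fun j => deg (.reeb j 0)).prod
  | [], b, h => by simp [chordProd] at h
  | [i], b, h => by
    have : Basic.reeb i 0 = b := by simpa [chordProd] using h
    simp [← this]
  | i :: j :: l, b, h => by
    obtain ⟨c, hc, hb⟩ := Option.bind_eq_some_iff.1 h
    rw [List.map_cons, List.prod_cons, ← deg_of_chordProd hmul (j :: l) c hc]
    exact hmul _ _ _ hb

theorem prod_deg_of_chordProd (hmul : ∀ b c e, b.mul c = some e → deg e = deg b * deg c) :
    ∀ (ws : List (List (ZMod 4))) (bs : List Basic), ws.map chordProd = bs.map some →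
      (bs.map deg).prod = (ws.flatten.map fun j => deg (.reeb j 0)).prod
  | [], [], _ => by simp
  | [], _ :: _, h => by simp at h
  | _ :: _, [], h => by simp at h
  | w :: ws, b :: bs, h => by
    rw [List.map_cons, List.map_cons, List.cons.injEq] at h
    rw [List.map_cons, List.prod_cons, prod_deg_of_chordProd hmul ws bs h.2,
      deg_of_chordProd hmul w b h.1, List.flatten_cons, List.map_append, List.prod_append]

variable {ld lw} (hd : ld ∈ Subgroup.center Γ) (hw : lw ∈ Subgroup.center Γ)
  (hu : u ∈ Subgroup.center Γ)
  (hmul : ∀ b c e, b.mul c = some e → deg e = deg b * deg c)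
  (hcurv : ∀ i, deg (.reeb i 3) = ld ^ (-2 : ℤ) * lw)
  (hbdry : ∀ (P : LabelledMap) (w : ℕ), P.IsTilingPattern → P.weight = w →
    ld ^ ((P.numLegs : ℤ) - 2) * lw ^ w *
      (P.boundaryDarts.map fun h => deg (.reeb (P.label h) 0)).prod = u ^ P.numVertices)
  (hidem : ∀ x, deg (.idem x) = 1)

include hd hw hu hmul hbdry hidem in
theorem output_mem_piece {P : LabelledMap} (hP : P.IsTilingPattern) {n w : ℕ} (b : Fin n → Basic)
    (hwt : P.weight = w) (hseq : P.chordSequence = (List.ofFn b).map some) :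
    P.output ∈ piece (extendDeg u deg)
      (ld ^ ((n : ℤ) - 2) * lw ^ w * (List.ofFn fun i => deg (b i)).prod) := by
  have hn : n = P.numLegs := by
    have := congrArg List.length hseq
    rw [LabelledMap.chordSequence, List.length_map, hP.length_sectorWords] at this
    simpa using this.symm
  have hz : ld ^ ((n : ℤ) - 2) * lw ^ w ∈ Subgroup.center Γ :=
    mul_mem (zpow_mem hd _) (pow_mem hw _)
  have hB := hbdry P w hP hwt
  rw [← hn] at hB
  have hprod := prod_deg_of_chordProd hmul _ _ hseq
  rw [List.map_ofFn] at hprod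
  change (List.ofFn fun i => deg (b i)).prod = _ at hprod
  rw [hprod]
  have hT : (P.boundaryDarts.map fun h => deg (.reeb (P.label h) 0)).prod =
      (P.quadrantWords.flatten.map fun j => deg (.reeb j 0)).prod := by
    rw [LabelledMap.IsTilingPattern.flatten_quadrantWords, List.map_map]
    rfl
  rw [hT] at hB
  generalize ld ^ ((n : ℤ) - 2) * lw ^ w = z at *
  rw [LabelledMap.output, LabelledMap.sectorWords]
  split
  · rw [hB, ← mul_one (u ^ P.numVertices), ← hidem]
    exact elt_mem_piece (extendDeg u deg) _ _
  · rename_i l _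
    refine eltOpt_mem_piece _ _ _ fun c hc => ?_
    -- The output chord precedes the boundary word here, so the central factor `z` must be moved
    -- past it; in the right-extended case the chord already stands behind.
    rw [flatten_modifyHead _ LabelledMap.IsTilingPattern.quadrantWords_ne_nil, List.map_append,
      List.prod_append, ← deg_of_chordProd hmul l c hc, ← mul_assoc,
      ← Subgroup.mem_center_iff.1 hz, mul_assoc, hB, Subgroup.mem_center_iff.1 (pow_mem hu _)]
  · rename_i l _
    refine eltOpt_mem_piece _ _ _ fun c hc => ?_
    rw [flatten_modifyLast _ LabelledMap.IsTilingPattern.quadrantWords_ne_nil, List.map_append,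
      List.prod_append, ← deg_of_chordProd hmul l c hc, ← mul_assoc, hB]

include hd hw hu hmul hbdry hidem hcurv in
theorem muBasic_mem_piece (n w : ℕ) (b : Fin n → Basic) :
    muBasic n w b ∈ piece (extendDeg u deg)
      (ld ^ ((n : ℤ) - 2) * lw ^ w * (List.ofFn fun i => deg (b i)).prod) := by
  unfold muBasic
  split
  · split_ifs with h
    · subst h
      refine Submodule.sum_mem _ fun i _ => ?_
      have := elt_mem_piece (extendDeg u deg) 0 (.reeb i 3)
      simpa [extendDeg, hcurv] using this
    · exact zero_mem _
  · refine eltOpt_mem_piece _ _ _ fun c hc => ?_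
    simp [List.ofFn_succ, hmul _ _ _ hc]
  · split_ifs with h
    · exact zero_mem _
    -- Closure under zero and addition suffices: a `finsum` with infinite support would be zero, so
    -- finiteness of the set of patterns is not needed.
    · refine finsum_mem_induction (fun x => x ∈ piece (extendDeg u deg) _) (zero_mem _)
        (fun _ _ => add_mem) fun c hc => ?_
      exact output_mem_piece hd hw hu hmul hbdry hidem (Quotient.out c).2 b hc.1 hc.2

include hd hw hu hmul hbdry hidem hcurv in
/-- A multiplicative assignment of degrees to the basic elements which has the right values on
the curvature and on the boundary words of the tiling patterns defines a grading. -/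
theorem isGrading_of_boundary : IsGrading mu iota ld lw (piece (extendDeg u deg)) := by
  have hom : ∀ (n w : ℕ) (g : Fin n → Γ) (a : Fin n → Alg),
      (∀ i, a i ∈ piece (extendDeg u deg) (g i)) →
      mu n w a ∈ piece (extendDeg u deg) (ld ^ ((n : ℤ) - 2) * lw ^ w * (List.ofFn g).prod) := by
    intro n w g a ha
    refine Submodule.sum_mem _ fun b _ => ?_
    refine smul_mem_piece (muBasic_mem_piece hd hw hu hmul hcurv hbdry hidem n w b) _ fun k hk => ?_
    -- A monomial U^k in the product of the coefficients arises from monomials U^(κ i) b_i in the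
    -- inputs, and these determine the degrees `g i`.
    obtain ⟨κ, rfl, h2⟩ := exists_coeff_ne_zero_of_prod _ _ hk
    have h3 : g = fun i => u ^ κ i * deg (b i) :=
      funext fun i => (eq_of_coeff_ne_zero (extendDeg u deg) (ha i) (h2 i (Finset.mem_univ i))).symm
    rw [h3, prod_ofFn_pow_mul hu]
    generalize ld ^ ((n : ℤ) - 2) * lw ^ w = z
    rw [← mul_assoc, ← mul_assoc z, Subgroup.mem_center_iff.1 (pow_mem hu _) z]
  have hiota : ∀ x, iota x ∈ piece (extendDeg u deg) 1 := fun x => by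
    simpa [extendDeg, hidem, iota] using elt_mem_piece (extendDeg u deg) 0 (.idem x)
  refine ⟨hd, hw, isInternal_piece _, fun x g a ha => ?_, fun x g a ha => ?_, hom⟩
  -- For n = 2 and w = 0 the prefactor is trivial, and idempotents have degree 1.
  · simpa using hom 2 0 ![1, g] ![iota x, a] (by simpa [Fin.forall_fin_two] using ⟨hiota x, ha⟩)
  · simpa using hom 2 0 ![g, 1] ![a, iota x] (by simpa [Fin.forall_fin_two] using ⟨ha, hiota x⟩)

end Grading

/-! ### Multiplicativity of the degrees on the path algebra -/

theorem reebDeg_zero (i : ZMod 4) : reebDeg i 0 = bigGen i := by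
  revert i
  decide +kernel

/-- The Maslov component in `reebDeg` is the one of the ordered product of generators. Lengthening a
chord by four multiplies its degree on the left by gr'(U), so only four lengths need checking. -/
theorem reebDeg_succ (i : ZMod 4) : ∀ n : ℕ, reebDeg i (n + 1) = reebDeg i n * bigGen (i + n + 1)
  | 0 => by revert i; decide +kernel
  | 1 => by revert i; decide +kernel
  | 2 => by revert i; decide +kernel
  | 3 => by revert i; decide +kernel
  | n + 4 => by
    have h4 : ((4 : ℕ) : ZMod 4) = 0 := by decide
    rw [show n + 4 + 1 = n + 1 + 4 by ring, reebDeg_add_four, reebDeg_succ i n, reebDeg_add_four,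
      mul_assoc, Nat.cast_add, h4, add_zero]

theorem reebDeg_add (i : ZMod 4) (n m : ℕ) :
    reebDeg i (n + m + 1) = reebDeg i n * reebDeg (i + n + 1) m := by
  induction m with
  | zero => rw [add_zero, reebDeg_succ, reebDeg_zero]
  | succ m ih =>
    rw [← add_assoc, reebDeg_succ, ih, reebDeg_succ (i + n + 1), mul_assoc]
    congr 3
    push_cast
    ring

theorem Basic.mul_eq_some {b c e : Basic} (h : b.mul c = some e) :
    basicDeg e = basicDeg b * basicDeg c ∧ e.left = b.left ∧ b.right = c.left ∧
      e.right = c.right := by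
  have h1 : (⟨0, 0, 0, 0, 0⟩ : Quintuple) = 1 := rfl
  rcases b with x | ⟨i, n⟩
  · rw [Basic.mul, Option.ite_none_right_eq_some] at h
    obtain ⟨rfl, he⟩ := h
    obtain rfl := Option.some.inj he
    exact ⟨by rw [basicDeg.eq_1, h1, one_mul], rfl, rfl, rfl⟩
  · rcases c with x | ⟨j, m⟩
    · rw [Basic.mul, Option.ite_none_right_eq_some] at h
      obtain ⟨rfl, he⟩ := h
      obtain rfl := Option.some.inj he
      exact ⟨by rw [basicDeg.eq_1, h1, mul_one], rfl, rfl, rfl⟩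
    · rw [Basic.mul, Option.ite_none_right_eq_some] at h
      obtain ⟨rfl, he⟩ := h
      obtain rfl := Option.some.inj he
      refine ⟨reebDeg_add i n m, rfl, rfl, ?_⟩
      simp only [Basic.right]
      congr 1
      push_cast
      ring

/-! ### The grading by the big group -/

/-- The degree of a basic element in the big grading group. -/
def bigDeg (b : Basic) : BigGroup := ⟨basicDeg b, basicDeg_mem b⟩

theorem big_diag_mem_center {x : ℚ} {y : ℤ} (h : (⟨x, y, y, y, y⟩ : Quintuple) ∈ bigSubgroup) :
    (⟨_, h⟩ : BigGroup) ∈ Subgroup.center BigGroup :=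
  Subgroup.mem_center_iff.2 fun g => Subtype.ext (Quintuple.diag_comm x y g.1).symm

theorem bigDeg_idem (x : Fin 2) : bigDeg (.idem x) = 1 := rfl

theorem bigDeg_mul (b c e : Basic) (h : b.mul c = some e) : bigDeg e = bigDeg b * bigDeg c :=
  Subtype.ext (Basic.mul_eq_some h).1

theorem bigDeg_curvature (i : ZMod 4) :
    bigDeg (.reeb i 3) = bigLambdaD ^ (-2 : ℤ) * bigLambdaW := by
  apply Subtype.ext
  have h : reebDeg i 3 = ⟨-1, 1, 1, 1, 1⟩ := by
    revert i
    decide +kernel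
  have h' : (⟨1, 0, 0, 0, 0⟩ : Quintuple) ^ (-2 : ℤ) * ⟨1, 1, 1, 1, 1⟩ = ⟨-1, 1, 1, 1, 1⟩ := by
    rw [Quintuple.diag_zpow, Quintuple.mul_def]
    norm_num
  exact h.trans h'.symm

theorem bigDeg_boundary (P : LabelledMap) (w : ℕ) (hP : P.IsTilingPattern) (hw : P.weight = w) :
    bigLambdaD ^ ((P.numLegs : ℤ) - 2) * bigLambdaW ^ w *
      (P.boundaryDarts.map fun h => bigDeg (.reeb (P.label h) 0)).prod = bigU ^ P.numVertices := by
  apply Subtype.ext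
  refine Eq.trans ?_ (hP.big_boundary w hw)
  have h : (((P.boundaryDarts.map fun h => bigDeg (.reeb (P.label h) 0)).prod : BigGroup) :
      Quintuple) = (P.boundaryDarts.map fun h => bigGen (P.label h)).prod := by
    rw [← Subgroup.coe_subtype, map_list_prod, List.map_map]
    congr 2
    funext h
    exact reebDeg_zero _
  rw [Subgroup.coe_mul, Subgroup.coe_mul, h]
  rfl

theorem isGrading_big : IsGrading mu iota bigLambdaD bigLambdaW (piece grBig) :=
  isGrading_of_boundary (deg := bigDeg) (big_diag_mem_center lambda_mem)
    (big_diag_mem_center lambdaW_mem) (big_diag_mem_center full_mem) bigDeg_mul bigDeg_curvature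
    bigDeg_boundary bigDeg_idem

/-! ### The grading by the intermediate group -/

theorem bigToInter_lambdaD : bigToInter bigLambdaD = interLambdaD := by
  apply Subtype.ext
  change quintupleToTriple ⟨1, 0, 0, 0, 0⟩ = ⟨1, 0, 0⟩
  simp [quintupleToTriple]

theorem bigToInter_lambdaW : bigToInter bigLambdaW = 1 := by
  apply Subtype.ext
  change quintupleToTriple ⟨1, 1, 1, 1, 1⟩ = ⟨0, 0, 0⟩
  simp [quintupleToTriple]

theorem inter_mem_center {g : InterGroup} (ha : g.1.a = 0) (hb : g.1.b = 0) :
    g ∈ Subgroup.center InterGroup :=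
  Subgroup.mem_center_iff.2 fun h => Subtype.ext <| by
    rw [Subgroup.coe_mul, Subgroup.coe_mul, Triple.mul_def, Triple.mul_def, ha, hb]
    ext <;> ring

theorem bigToInter_U_ab : (bigToInter bigU).1.a = 0 ∧ (bigToInter bigU).1.b = 0 := by
  change (quintupleToTriple ⟨-1, 1, 1, 1, 1⟩).a = 0 ∧ (quintupleToTriple ⟨-1, 1, 1, 1, 1⟩).b = 0
  simp [quintupleToTriple]

theorem bigToInter_U_mem_center : bigToInter bigU ∈ Subgroup.center InterGroup :=
  inter_mem_center bigToInter_U_ab.1 bigToInter_U_ab.2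

theorem interLambdaD_mem_center : interLambdaD ∈ Subgroup.center InterGroup :=
  inter_mem_center rfl rfl

/-- The degree of a basic element in the intermediate grading group. -/
def interDeg (b : Basic) : InterGroup := bigToInter (bigDeg b)

theorem interDeg_boundary (P : LabelledMap) (w : ℕ) (hP : P.IsTilingPattern) (hw : P.weight = w) :
    interLambdaD ^ ((P.numLegs : ℤ) - 2) * 1 ^ w *
      (P.boundaryDarts.map fun h => interDeg (.reeb (P.label h) 0)).prod =
        bigToInter bigU ^ P.numVertices := by
  have h := congrArg bigToInter (bigDeg_boundary P w hP hw)
  rwa [map_mul, map_mul, map_zpow, map_pow, map_pow, map_list_prod, List.map_map,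
    bigToInter_lambdaD, bigToInter_lambdaW] at h

theorem interDeg_curvature (i : ZMod 4) :
    interDeg (.reeb i 3) = interLambdaD ^ (-2 : ℤ) * 1 := by
  rw [interDeg, bigDeg_curvature, map_mul, map_zpow, bigToInter_lambdaD, bigToInter_lambdaW]

theorem grInter_eq (k : ℕ) (b : Basic) : grInter k b = bigToInter bigU ^ k * interDeg b := by
  rw [grInter, grBig, map_mul, map_pow]
  rfl

theorem isGrading_inter : IsGrading mu iota interLambdaD 1 (piece grInter) := by
  have h : grInter = extendDeg (bigToInter bigU) interDeg := by
    funext k b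
    exact grInter_eq k b
  rw [h]
  exact isGrading_of_boundary interLambdaD_mem_center (one_mem _) bigToInter_U_mem_center
    (fun b c e h => by rw [interDeg, bigDeg_mul b c e h, map_mul]; rfl) interDeg_curvature
    interDeg_boundary fun x => by rw [interDeg, bigDeg_idem, map_one]

/-! ### The grading by the small group -/

theorem small_mem_center {g : SmallGroup} (hg : g.1 ∈ Subgroup.center InterGroup) :
    g ∈ Subgroup.center SmallGroup :=
  Subgroup.mem_center_iff.2 fun h => Subtype.ext (Subgroup.mem_center_iff.1 hg h.1)

/-- The degree of `U` in the small grading group. -/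
def smallU : SmallGroup :=
  ⟨bigToInter bigU, ⟨0, by rw [bigToInter_U_ab.1, Int.cast_zero]⟩,
    ⟨0, by rw [bigToInter_U_ab.2, Int.cast_zero]⟩⟩

theorem refinedDeg_zero (b : Basic) :
    refinedDeg 0 b = psi b.left * interDeg b * (psi b.right)⁻¹ := by
  rw [refinedDeg, grInter_eq, pow_zero, one_mul]

theorem grSmall_eq (k : ℕ) (b : Basic) : grSmall k b = smallU ^ k * grSmall 0 b := by
  apply Subtype.ext
  change refinedDeg k b = bigToInter bigU ^ k * refinedDeg 0 b
  rw [refinedDeg_zero, refinedDeg, grInter_eq, ← mul_assoc, ← mul_assoc, ← mul_assoc,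
    Subgroup.mem_center_iff.1 (pow_mem bigToInter_U_mem_center k)]

theorem grSmall_mul (b c e : Basic) (h : b.mul c = some e) :
    grSmall 0 e = grSmall 0 b * grSmall 0 c := by
  apply Subtype.ext
  change refinedDeg 0 e = refinedDeg 0 b * refinedDeg 0 c
  obtain ⟨-, h1, h2, h3⟩ := Basic.mul_eq_some h
  rw [refinedDeg_zero, refinedDeg_zero, refinedDeg_zero, h1, h2, h3, interDeg, bigDeg_mul b c e h,
    map_mul]
  simp only [interDeg]
  group

/-- At a leg the label drops by one instead of rising by one; the two results differ by 2, and
`source` depends only on parity. -/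
theorem LabelledMap.IsTilingPattern.source_label_face {P : LabelledMap} (hP : P.IsTilingPattern)
    (h : Fin P.size) : source (P.label (P.face h)) = source (P.label h + 1) := by
  by_cases hl : P.IsLeg h
  · have hs : ∀ j : ZMod 4, source (j - 1) = source (j + 1) := by decide
    rw [← hs, ← hP.label_rot]
    congr 2
    exact congrArg P.rot hl
  · rw [← hP.label_opp h hl]
    rfl

/-- Consecutive boundary chords, even across a leg, have matching idempotents, so the inner factors
ψ cancel. The word closes up, so the outer two are inverse to each other. -/
theorem prod_refinedDeg {P : LabelledMap} (hP : P.IsTilingPattern) :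
    (P.boundaryDarts.map fun h => refinedDeg 0 (.reeb (P.label h) 0)).prod =
      psi (source (P.label P.root + 1)) *
        (P.boundaryDarts.map fun h => interDeg (.reeb (P.label h) 0)).prod *
        (psi (source (P.label P.root + 1)))⁻¹ := by
  have step : ∀ m : ℕ,
      (((List.range m).map fun k => (P.face ^ (k + 1)) P.root).map
        fun h => refinedDeg 0 (.reeb (P.label h) 0)).prod =
      psi (source (P.label P.root + 1)) *
        (((List.range m).map fun k => (P.face ^ (k + 1)) P.root).map
          fun h => interDeg (.reeb (P.label h) 0)).prod *
        (psi (source (P.label ((P.face ^ m) P.root) + 1)))⁻¹ := by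
    intro m
    induction m with
    | zero => simp
    | succ m ih =>
      have hs : source (P.label ((P.face ^ (m + 1)) P.root)) =
          source (P.label ((P.face ^ m) P.root) + 1) := by
        rw [pow_succ', Equiv.Perm.mul_apply, hP.source_label_face]
      rw [List.range_succ, List.map_append, List.map_append, List.map_append, List.prod_append,
        List.prod_append, ih, List.map_singleton, List.map_singleton, List.map_singleton,
        List.prod_singleton, List.prod_singleton, refinedDeg_zero]
      simp only [Basic.left, Basic.right, Nat.cast_zero, add_zero, hs]
      group
  have h := step (Function.minimalPeriod P.face P.root)
  rwa [Equiv.Perm.coe_pow P.face (Function.minimalPeriod P.face P.root),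
    Function.iterate_minimalPeriod] at h

theorem grSmall_boundary (P : LabelledMap) (w : ℕ) (hP : P.IsTilingPattern) (hw : P.weight = w) :
    smallLambdaD ^ ((P.numLegs : ℤ) - 2) * 1 ^ w *
      (P.boundaryDarts.map fun h => grSmall 0 (.reeb (P.label h) 0)).prod =
        smallU ^ P.numVertices := by
  apply Subtype.ext
  have h : (((P.boundaryDarts.map fun h => grSmall 0 (.reeb (P.label h) 0)).prod : SmallGroup) :
      InterGroup) = (P.boundaryDarts.map fun h => refinedDeg 0 (.reeb (P.label h) 0)).prod := by
    rw [← Subgroup.coe_subtype, map_list_prod, List.map_map]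
    rfl
  rw [Subgroup.coe_mul, Subgroup.coe_mul, h, prod_refinedDeg hP]
  change interLambdaD ^ ((P.numLegs : ℤ) - 2) * 1 ^ w * _ = bigToInter bigU ^ P.numVertices
  have hB := interDeg_boundary P w hP hw
  have hz : interLambdaD ^ ((P.numLegs : ℤ) - 2) * 1 ^ w ∈ Subgroup.center InterGroup :=
    mul_mem (zpow_mem interLambdaD_mem_center _) (pow_mem (one_mem _) _)
  generalize interLambdaD ^ ((P.numLegs : ℤ) - 2) * 1 ^ w = z at *
  -- Moving `z` inside the conjugation turns the conjugated element into a power of the degree of U,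
  -- which is central.
  rw [← mul_assoc, ← mul_assoc, ← Subgroup.mem_center_iff.1 hz, mul_assoc _ z, hB,
    Subgroup.mem_center_iff.1 (pow_mem bigToInter_U_mem_center _), mul_inv_cancel_right]

theorem isGrading_small : IsGrading mu iota smallLambdaD 1 (piece grSmall) := by
  have h : grSmall = extendDeg smallU (grSmall 0) := by
    funext k b
    exact grSmall_eq k b
  rw [h]
  refine isGrading_of_boundary (small_mem_center interLambdaD_mem_center) (one_mem _)
    (small_mem_center bigToInter_U_mem_center) grSmall_mul (fun i => Subtype.ext ?_)
    grSmall_boundary fun x => Subtype.ext ?_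
  · change refinedDeg 0 (.reeb i 3) = interLambdaD ^ (-2 : ℤ) * 1
    -- A chord of length four is a loop, so refinement conjugates its central degree and leaves it
    -- unchanged.
    have hr : (Basic.reeb i 3).right = (Basic.reeb i 3).left := by
      revert i
      decide
    rw [refinedDeg_zero, interDeg_curvature, hr, mul_one,
      Subgroup.mem_center_iff.1 (zpow_mem interLambdaD_mem_center _), mul_inv_cancel_right]
  · change refinedDeg 0 (.idem x) = 1
    rw [refinedDeg_zero, interDeg, bigDeg_idem, map_one, mul_one]
    exact mul_inv_cancel _

end TorusAlgebra

theorem mainTheorem7 :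
    -- the grading by the big group `G'`
    IsGrading mu iota bigLambdaD bigLambdaW (piece grBig) ∧
    -- the grading induced by the homomorphism `G' → G`
    (bigToInter bigLambdaD = interLambdaD ∧ bigToInter bigLambdaW = 1 ∧
      IsGrading mu iota interLambdaD 1 (piece grInter)) ∧
    -- the grading by `G(𝕋)` obtained by grading refinement
    IsGrading mu iota smallLambdaD 1 (piece grSmall) :=
  ⟨isGrading_big, ⟨bigToInter_lambdaD, bigToInter_lambdaW, isGrading_inter⟩, isGrading_small⟩
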